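/- Let $(a_k)_{k\ge 1}$ be any sequence of integers. Write $S^1=\mathbb R/\mathbb Z$, $e_2(\theta)=2\theta \bmod 1$, and let $\mathcal P\subset\mathbb N$ be the set containing $1$ iff $a_1\ne 1$ and containing $k\ge 2$ iff $a_k\neq 0$. Let $\Lambda\subset S^1$ be a union of periodic orbits of $e_2$, with exactly one orbit of (minimal) period $k$ for each $k\in\mathcal P$ and none of any other period, such that no accumulation point of $\Lambda$ is periodic under $e_2$. Write $\Lambda'$ for the set of accumulation points, and $g_0(\theta)=\operatorname{dist}(\theta,\Lambda')$ ($g_0\equiv 1$ if $\Lambda'=\emptyset$). Let $\Lambda^*=\bigcup_{j\ge 0}e_2^{-j}(\Lambda)$, and let $\pi:S^1\to S^1$ be a continuous monotone map of degree one such that $J_x:=\pi^{-1}(x)$ is a non-degenerate interval for $x\in\Lambda^*$ and a single point for $x\notin\Lambda^*$. *Sector dynamics.* Fix continuous $c_-:[-1,1]\to[1/2,1]$ and $c_+:[-1,1]\to[1,2]$ such that $c_\pm^{-1}(1)=\{-1,0,1\}$ and $s\mapsto s\,c_\pm(s)$ is strictly increasing on $[-1,1]$. For $m\ge1$ and a sign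 $*\in\{+,-\}$, divide $[0,1]$ into $m$ equal intervals, and identify each of them with $[-1,1]$ by the increasing affine map; let $\varphi_{m,*}:[0,1]\to[0,1]$ be the map $s\mapsto s\,c_*(s)$ on each of them, and let $\rho_m:[0,1]\to[-1,1]$ be the function $s\mapsto 2s^2-1$ on each of them. For $\alpha\in\Lambda$ of period $k$ put $t_k=a_1-1$ if $k=1$ and $t_k=a_k$ if $k\ge2$, and let $m_\alpha=|t_k|\ge 1$ and $*_\alpha$ be the sign of $t_k$. *The map.* Define $h:S^1\to S^1$ with $\pi\circ h=e_2\circ\pi$ and $g:S^1\to\mathbb R$ as follows. If $\pi(\theta)\notin\Lambda^*$, then $h(\theta)$ is the unique point of $\pi^{-1}(e_2(\pi(\theta)))$ and $g(\theta)=g_0(\pi(\theta))$. If $x\in\Lambda^*\setminus\Lambda$, then $h$ maps $J_x$ onto $J_{e_2(x)}$ by the increasing affine map and $g\equiv g_0(x)$ on $J_x$. If $\alpha\in\Lambda$, then in the increasing affine coordinates in $[0,1]$ on $J_\alpha$ and $J_{e_2(\alpha)}$, $h:J_\alpha\to J_{e_2(\alpha)}$ is $\varphi_{m_\alpha,*_\alpha}$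 and $g=g_0(\alpha)\,\rho_{m_\alpha}$ on $J_\alpha$. Let $f:\mathbb R^2\to\mathbb R^2$ fix the origin $o$ and be given elsewhere by $f:(\theta,r)\mapsto(h(\theta),\,r-g(\theta))$, where $(\theta,r)\in S^1\times\mathbb R$ denotes the point at distance $e^{r}$ from $o$ with polar angle $2\pi\theta$ (in this formula $2\pi$ is the number). Then for every $n\ge1$ the map $f^n$ is continuous, $o$ is an isolated fixed point of $f^n$, and its fixed point index (the number of turns of $x-f^n(x)$ as $x$ runs once counterclockwise along the boundary of any closed disc centred at $o$ that contains no other fixed point of $f^n$) is $$i(f^n,o)=\sum_{k\mid n}k\,a_k .$$ -/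

import Mathlib

open Set

noncomputable section

namespace PlanarIndex

/-! ### Fixed point index in the plane -/

/-- The curve `η : [0,1] → ℂ` avoids `0` and turns `w` times around `0`: along a continuous
determination `θ` of its argument, the total variation of the angle is `2 π w`. -/
def HasWindingNumber (η : ℝ → ℂ) (w : ℤ) : Prop :=
  ∃ θ : ℝ → ℝ, ContinuousOn θ (Icc 0 1) ∧
    (∀ t ∈ Icc (0 : ℝ) 1, η t ≠ 0 ∧ η t = (‖η t‖ : ℂ) * Complex.exp (θ t * Complex.I)) ∧
    θ 1 - θ 0 = 2 * Real.pi * w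

/-- The circle of centre `p` and radius `R`, run through once counterclockwise on `[0,1]`. -/
def circleCurve (p : ℂ) (R : ℝ) (t : ℝ) : ℂ :=
  p + R * Complex.exp (2 * Real.pi * t * Complex.I)

/-- The closed disc of radius `R > 0` about `p` contains no fixed point of `f` except `p`. -/
def IsIsolatingRadius (f : ℂ → ℂ) (p : ℂ) (R : ℝ) : Prop :=
  0 < R ∧ ∀ x ∈ Metric.closedBall p R, f x = x → x = p

/-- `f` is a continuous planar map, `p` is an isolated fixed point of `f`, and the fixed point
index `i(f, p)` is `k`: the vector `x - f x` makes `k` turns as `x` runs through the boundary of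
any closed disc about `p` which contains no other fixed point. -/
structure HasFixedPointIndex (f : ℂ → ℂ) (p : ℂ) (k : ℤ) : Prop where
  continuous : Continuous f
  isFixed : f p = p
  isolated : ∃ R, IsIsolatingRadius f p R
  winding : ∀ R, IsIsolatingRadius f p R →
    HasWindingNumber (fun t => circleCurve p R t - f (circleCurve p R t)) k

/-! ### The base dynamics and the periodic orbits that are blown up -/

/-- The doubling map `θ ↦ 2θ mod 1` of the circle `ℝ / ℤ`. -/
def doubling (x : UnitAddCircle) : UnitAddCircle := (2 : ℕ) • x

/-- The periods at which the dynamics has to be modified: `1` if `a₁ ≠ 1`, and every `k ≥ 2`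
with `a_k ≠ 0`. -/
def modifiedPeriods (a : ℕ → ℤ) : Set ℕ :=
  {k | (k = 1 ∧ a 1 ≠ 1) ∨ (2 ≤ k ∧ a k ≠ 0)}

/-- `Λ` is composed of exactly one orbit of the doubling map of each (minimal) period in `P`, and
no accumulation point of `Λ` is periodic. -/
structure IsOrbitFamily (P : Set ℕ) (Λ : Set UnitAddCircle) : Prop where
  periodic : Λ ⊆ Function.periodicPts doubling
  invariant : MapsTo doubling Λ Λ
  periods : Function.minimalPeriod doubling '' Λ = P
  one_orbit : ∀ α ∈ Λ, ∀ β ∈ Λ,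
    Function.minimalPeriod doubling α = Function.minimalPeriod doubling β →
      ∃ j : ℕ, doubling^[j] α = β
  derived : Disjoint (derivedSet Λ) (Function.periodicPts doubling)

/-- The angles whose forward orbit under the doubling map meets `Λ`. -/
def backwardOrbit (Λ : Set UnitAddCircle) : Set UnitAddCircle :=
  {x | ∃ k : ℕ, doubling^[k] x ∈ Λ}

open Classical in
/-- `g₀(θ) = dist(θ, Λ')`, read as the constant `1` if the derived set `Λ'` is empty. -/
def baseRadial (Λ : Set UnitAddCircle) (x : UnitAddCircle) : ℝ :=
  if derivedSet Λ = ∅ then 1 else Metric.infDist x (derivedSet Λ)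

/-! ### Blowing up points of the circle -/

/-- `q` is a lift to `ℝ` of a continuous monotone circle map of degree one which collapses an
interval to each point of `B` and is injective elsewhere. -/
structure IsBlowUp (q : CircleDeg1Lift) (B : Set UnitAddCircle) : Prop where
  continuous : Continuous q
  nontrivial_iff : ∀ x : ℝ, (q ⁻¹' {x}).Nontrivial ↔ (x : UnitAddCircle) ∈ B

/-- Left endpoint of the compact interval `J_x = q⁻¹(x)`. -/
def leftEnd (q : CircleDeg1Lift) (x : ℝ) : ℝ := sInf (q ⁻¹' {x})

/-- Right endpoint of the compact interval `J_x = q⁻¹(x)`. -/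
def rightEnd (q : CircleDeg1Lift) (x : ℝ) : ℝ := sSup (q ⁻¹' {x})

/-- The affine coordinate in `[0,1]` of `y` in the interval `J_x` to which it belongs
(it is `0` if that interval is a point). -/
def fibreCoord (q : CircleDeg1Lift) (y : ℝ) : ℝ :=
  (y - leftEnd q (q y)) / (rightEnd q (q y) - leftEnd q (q y))

/-! ### The model dynamics in a sector -/

/-- The angular profiles `c₋ : [-1,1] → [1/2,1]`. -/
structure IsMinusProfile (c : ℝ → ℝ) : Prop where
  continuousOn : ContinuousOn c (Icc (-1) 1)
  mapsTo : MapsTo c (Icc (-1) 1) (Icc (1 / 2) 1)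
  eq_one_iff : ∀ s ∈ Icc (-1 : ℝ) 1, c s = 1 ↔ s = -1 ∨ s = 0 ∨ s = 1
  strictMonoOn : StrictMonoOn (fun s => s * c s) (Icc (-1) 1)

/-- The angular profiles `c₊ : [-1,1] → [1,2]`. -/
structure IsPlusProfile (c : ℝ → ℝ) : Prop where
  continuousOn : ContinuousOn c (Icc (-1) 1)
  mapsTo : MapsTo c (Icc (-1) 1) (Icc 1 2)
  eq_one_iff : ∀ s ∈ Icc (-1 : ℝ) 1, c s = 1 ↔ s = -1 ∨ s = 0 ∨ s = 1
  strictMonoOn : StrictMonoOn (fun s => s * c s) (Icc (-1) 1)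

/-- Divide `[0,1]` into `m` equal pieces and identify each of them affinely with `[-1,1]`: the
coordinate of `t` in its piece. (A common endpoint is given the coordinate `-1` of the piece on
its right; the two maps below take the same values with either choice.) -/
def pieceCoord (m : ℕ) (t : ℝ) : ℝ := 2 * Int.fract (m * t) - 1

/-- The angular part of the model `f_{m,±}` on `[0,1]`: in each of the `m` pieces, `s ↦ s · c(s)`
in the coordinate of that piece. -/
def modelAngle (m : ℕ) (c : ℝ → ℝ) (t : ℝ) : ℝ :=
  (⌊m * t⌋ + (pieceCoord m t * c (pieceCoord m t) + 1) / 2) / m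

/-- The model `f_{m,±}` has radial part `r ↦ r + 1 - 2 s²` in each piece, that is
`r ↦ r - modelRadial m t`. -/
def modelRadial (m : ℕ) (t : ℝ) : ℝ := 2 * pieceCoord m t ^ 2 - 1

/-- The signed number of turns prescribed in each sector of period `k`: its absolute value is `m`
and its sign selects `f_{m,+}` or `f_{m,-}`. -/
def turns (a : ℕ → ℤ) (k : ℕ) : ℤ := if k = 1 then a 1 - 1 else a k

/-- The number `m` at the angle `α`. -/
def sectorCount (a : ℕ → ℤ) (α : UnitAddCircle) : ℕ :=
  (turns a (Function.minimalPeriod doubling α)).natAbs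

/-- The profile, `c₊` or `c₋`, used at the angle `α`. -/
def sectorProfile (a : ℕ → ℤ) (cPlus cMinus : ℝ → ℝ) (α : UnitAddCircle) : ℝ → ℝ :=
  if 0 < turns a (Function.minimalPeriod doubling α) then cPlus else cMinus

/-! ### The planar map -/

open Classical in
/-- The lift to `ℝ` of the map `h` with `q ∘ h = 2 q`. It maps `J_x` onto `J_{2x}`, in the
affine coordinates of the two intervals by the angular part of `f_{m,±}` if `x ∈ Λ`, and by the
identity otherwise. -/
def angularMap (a : ℕ → ℤ) (cPlus cMinus : ℝ → ℝ) (Λ : Set UnitAddCircle) (q : CircleDeg1Lift)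
    (y : ℝ) : ℝ :=
  leftEnd q (2 * q y) + (rightEnd q (2 * q y) - leftEnd q (2 * q y)) *
    (if (q y : UnitAddCircle) ∈ Λ then
      modelAngle (sectorCount a (q y : UnitAddCircle))
        (sectorProfile a cPlus cMinus (q y : UnitAddCircle)) (fibreCoord q y)
    else fibreCoord q y)

open Classical in
/-- The function `g`: it is `g₀ ∘ q` outside the sectors over `Λ`, and in the sector over `α ∈ Λ`
it is the radial part of the model, scaled by `g₀(α)`. -/
def radialMap (a : ℕ → ℤ) (Λ : Set UnitAddCircle) (q : CircleDeg1Lift) (y : ℝ) : ℝ :=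
  baseRadial Λ (q y : UnitAddCircle) *
    (if (q y : UnitAddCircle) ∈ Λ then
      modelRadial (sectorCount a (q y : UnitAddCircle)) (fibreCoord q y)
    else 1)

/-- The planar map fixing the origin and given by `(θ, r) ↦ (h θ, r - g θ)` elsewhere, where
`(θ, r)` stands for the point `exp r * exp (2 π i θ)`. -/
def planarMap (a : ℕ → ℤ) (cPlus cMinus : ℝ → ℝ) (Λ : Set UnitAddCircle) (q : CircleDeg1Lift)
    (z : ℂ) : ℂ :=
  if z = 0 then 0
  else
    (Real.exp (Real.log ‖z‖ - radialMap a Λ q (Complex.arg z / (2 * Real.pi))) : ℂ) *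
      Complex.exp (2 * Real.pi *
        angularMap a cPlus cMinus Λ q (Complex.arg z / (2 * Real.pi)) * Complex.I)

end PlanarIndex

end

namespace PlanarIndex

open Filter Topology

/-! ### Winding numbers by counting crossings of the negative real axis -/

/-! In the coordinate r + 2πiθ the radial displacement of f depends on the angle only, so fⁿ(z)/z is
a function of the angle. Hence z - fⁿ(z) = z(1 - fⁿ(z)/z) on every circle about the origin
(`sub_planarMap_iterate`): the factor z makes one turn, and the rest is the winding of the closed
curve `ratioCurve`, which does not depend on the radius.

That winding is a signed count of crossings of the negative real axis
(`hasWindingNumber_of_crossings`). The curve is real and ≤ 0 only in a direction fixed by hⁿ along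
which the summed radial displacement G is ≤ 0. Off Λ, G at a fixed direction is a sum of values of
g₀ along a periodic orbit, hence positive, because no periodic point is an accumulation point of Λ.
Over Λ, a fixed direction is an end of a piece, where the model has radial part 1 and G > 0, or the
centre of a piece, where it has radial part -1 and G < 0 (`radialSum_pos_or`, `radialSum_neg`). So
the crossings are exactly the centres of the pieces over those α ∈ Λ with 2ⁿα = α. With c₊ the
centre repels in the angular direction and the crossing counts +1; with c₋ it attracts and counts -1
(`ratioCurve_crossing`). An orbit of period k dividing n has k points, each with |t_k| pieces of the
sign of t_k, so it contributes k·t_k. As t₁ = a₁ - 1, the single turn of z restores the sum of k·a_k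
(`sum_turns`).

For continuity, the lift of h is monotone and surjective, while g is dominated by g₀, which vanishes
on Λ', and has no jump at the ends of a sector because the model has radial part 1 there. -/

theorem eventually_ceil_eq {x : ℝ} (hx : ∀ k : ℤ, x ≠ k) : ∀ᶠ y in 𝓝 x, ⌈y⌉ = ⌈x⌉ := by
  have h1 : (⌈x⌉ : ℝ) - 1 < x := by linarith [Int.ceil_lt_add_one x]
  have h2 : x < ⌈x⌉ := lt_of_le_of_ne (Int.le_ceil x) (hx _)
  filter_upwards [Ioo_mem_nhds h1 h2] with y hy
  exact Int.ceil_eq_iff.2 ⟨hy.1, hy.2.le⟩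

/-- The principal argument jumps only at the points of p i + ℤ, by -2π σ i in the direction of
increasing t. A step function counting these points with sign cancels the jumps, and over one period
it grows by the sum of the σ i. -/
theorem hasWindingNumber_of_crossings {ι : Type*} [Fintype ι] {η : ℝ → ℂ} (hc : Continuous η)
    (hper : Function.Periodic η 1) (p : ι → ℝ) (σ : ι → ℤ) (hσ : ∀ i, σ i = 1 ∨ σ i = -1)
    (hinj : ∀ i j (k : ℤ), p i = p j + k → i = j)
    (hslit : ∀ t, (∀ i (k : ℤ), t ≠ p i + k) → η t ∈ Complex.slitPlane)
    (hre : ∀ i, (η (p i)).re < 0) (him : ∀ i, (η (p i)).im = 0)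
    (hcross : ∀ i, ∀ᶠ t in 𝓝 (p i), ((σ i : ℝ) * (t - p i) < 0 → 0 < (η t).im) ∧
      (0 < (σ i : ℝ) * (t - p i) → (η t).im < 0)) :
    ∃ θ : ℝ → ℝ, Continuous θ ∧
      (∀ t, η t ≠ 0 ∧ η t = (‖η t‖ : ℂ) * Complex.exp (θ t * Complex.I)) ∧
      θ 1 - θ 0 = 2 * Real.pi * ((∑ i, σ i : ℤ) : ℝ) := by
  classical
  have hperk : ∀ (t : ℝ) (k : ℤ), η (t + k) = η t := fun t k => by
    simpa using hper.int_mul k t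
  have hconst : ∀ t i, (∀ k : ℤ, t ≠ p i + k) →
      ∀ᶠ s in 𝓝 t, ⌈(σ i : ℝ) * (s - p i)⌉ = ⌈(σ i : ℝ) * (t - p i)⌉ := by
    intro t i ht
    have hne : ∀ k : ℤ, (σ i : ℝ) * (t - p i) ≠ k := by
      intro k hk
      rcases hσ i with h | h
      · apply ht k; rw [h] at hk; push_cast at hk; linarith
      · apply ht (-k); rw [h] at hk; push_cast at hk ⊢; linarith
    have hcont : ContinuousAt (fun s : ℝ => (σ i : ℝ) * (s - p i)) t := by fun_prop
    exact hcont.eventually (eventually_ceil_eq hne)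
  -- The ceiling, not the floor: on the negative axis `arg` is π, its limit from the upper half
  -- plane, which is the side where σ(t - p) < 0; the ceiling at 0 likewise agrees with its values
  -- just below 0.
  refine ⟨fun t => (η t).arg + 2 * Real.pi * ((∑ i, ⌈(σ i : ℝ) * (t - p i)⌉ : ℤ) : ℝ), ?_, ?_, ?_⟩
  · rw [continuous_iff_continuousAt]
    intro t
    by_cases ht : ∀ i (k : ℤ), t ≠ p i + k
    · have hev : ∀ᶠ s in 𝓝 t, ∀ i, ⌈(σ i : ℝ) * (s - p i)⌉ = ⌈(σ i : ℝ) * (t - p i)⌉ :=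
        eventually_all.2 fun i => hconst t i (ht i)
      have hcont : ContinuousAt (fun s => (η s).arg +
          2 * Real.pi * ((∑ i, ⌈(σ i : ℝ) * (t - p i)⌉ : ℤ) : ℝ)) t :=
        ((Complex.continuousAt_arg (hslit t ht)).comp hc.continuousAt).add continuousAt_const
      refine hcont.congr ?_
      filter_upwards [hev] with s hs
      simp only [hs]
    · push Not at ht
      obtain ⟨i, k, rfl⟩ := ht
      have hev : ∀ᶠ s in 𝓝 (p i + k), ∀ j, j ≠ i →
          ⌈(σ j : ℝ) * (s - p j)⌉ = ⌈(σ j : ℝ) * (p i + k - p j)⌉ := by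
        refine eventually_all.2 fun j => ?_
        by_cases hj : j = i
        · exact Eventually.of_forall fun s h => absurd hj h
        · have := hconst (p i + k) j (fun l hl => hj (hinj i j (l - k) (by
            push_cast; linarith)).symm)
          filter_upwards [this] with s hs _ using hs
      have htr : Tendsto (fun s : ℝ => s - k) (𝓝 (p i + k)) (𝓝 (p i)) := by
        have : Tendsto (fun s : ℝ => s - k) (𝓝 (p i + k)) (𝓝 (p i + k - k)) :=
          (continuous_id.sub continuous_const).tendsto _
        simpa using this
      have hη : ∀ s : ℝ, η (s - k) = η s := fun s => by
        rw [← hperk (s - k) k]; congr 1; ring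
      have hnear : ∀ᶠ s in 𝓝 (p i), |s - p i| < 1 := by
        have : ContinuousAt (fun s : ℝ => |s - p i|) (p i) := by fun_prop
        exact this.eventually (gt_mem_nhds (by simp))
      have hneg : ∀ᶠ s in 𝓝 (p i), (η s).re < 0 :=
        (Complex.continuous_re.comp hc).continuousAt.eventually (gt_mem_nhds (hre i))
      -- Near a crossing -η has positive real part, so arg(-η) + π is continuous there; the proposed
      -- angle is shown to equal it up to a local constant.
      have hcont : ContinuousAt (fun s => (-η s).arg + Real.pi + 2 * Real.pi *
          ((σ i * k + ∑ j ∈ Finset.univ.erase i, ⌈(σ j : ℝ) * (p i + k - p j)⌉ : ℤ) : ℝ))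
          (p i + k) := by
        have hs : -η (p i + k) ∈ Complex.slitPlane := by
          rw [hperk]; left; simpa using hre i
        exact ((ContinuousAt.comp (f := fun s => -η s) (Complex.continuousAt_arg hs) hc.neg.continuousAt).add
          continuousAt_const).add continuousAt_const
      refine hcont.congr ?_
      filter_upwards [hev, htr.eventually hnear, htr.eventually (hcross i),
        htr.eventually hneg] with s hs hs1 hs2 hs3
      rw [hη] at hs2 hs3
      rw [← Finset.add_sum_erase _ _ (Finset.mem_univ i),
        Finset.sum_congr rfl (fun j hj => hs j (Finset.ne_of_mem_erase hj))]
      have hceil : ⌈(σ i : ℝ) * (s - p i)⌉ = ⌈(σ i : ℝ) * (s - k - p i)⌉ + σ i * k := by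
        rw [← Int.ceil_add_intCast]; congr 1; push_cast; ring
      rw [hceil]
      have habs : |(σ i : ℝ) * (s - k - p i)| < 1 := by
        rw [abs_mul]
        rcases hσ i with h | h <;> simpa [h] using hs1
      rw [abs_lt] at habs
      have key : (η s).arg + 2 * Real.pi * (⌈(σ i : ℝ) * (s - k - p i)⌉ : ℝ) =
          (-η s).arg + Real.pi := by
        rcases lt_trichotomy ((σ i : ℝ) * (s - k - p i)) 0 with h | h | h
        · have : ⌈(σ i : ℝ) * (s - k - p i)⌉ = 0 := Int.ceil_eq_iff.2 (by
            constructor <;> push_cast <;> linarith)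
          rw [this, Complex.arg_neg_eq_arg_sub_pi_of_im_pos (hs2.1 h)]; simp
        · have hsk : s = p i + k := by
            rcases hσ i with h' | h' <;> rw [h'] at h <;> push_cast at h <;> linarith
          have h0 : (η s).im = 0 := by rw [hsk, hperk, him]
          have h1 : (η s).arg = Real.pi := Complex.arg_eq_pi_iff.2 ⟨hs3, h0⟩
          have h2 : (-η s).arg = 0 := Complex.arg_eq_zero_iff.2 (by simp [h0, hs3.le])
          rw [h, h1, h2]; simp
        · have : ⌈(σ i : ℝ) * (s - k - p i)⌉ = 1 := Int.ceil_eq_iff.2 (by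
            constructor <;> push_cast <;> linarith)
          rw [this, Complex.arg_neg_eq_arg_add_pi_of_im_neg (hs2.2 h)]; push_cast; ring
      rw [← key]; push_cast; ring
  · intro t
    have hne : η t ≠ 0 := by
      by_cases ht : ∀ i (k : ℤ), t ≠ p i + k
      · exact Complex.slitPlane_ne_zero (hslit t ht)
      · push Not at ht
        obtain ⟨i, k, rfl⟩ := ht
        intro h
        have := hre i
        rw [hperk] at h
        simp [h] at this
    refine ⟨hne, ?_⟩
    conv_lhs => rw [← Complex.norm_mul_exp_arg_mul_I (η t)]
    congr 1
    rw [Complex.exp_eq_exp_iff_exists_int]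
    refine ⟨-(∑ i, ⌈(σ i : ℝ) * (t - p i)⌉), ?_⟩
    push_cast; ring
  · have h10 : η 1 = η 0 := by simpa using hper 0
    have : ∀ i, ⌈(σ i : ℝ) * (1 - p i)⌉ = ⌈(σ i : ℝ) * (0 - p i)⌉ + σ i := fun i => by
      rw [← Int.ceil_add_intCast]; congr 1; ring
    simp only [h10, this, Finset.sum_add_distrib]
    push_cast; ring

end PlanarIndex

namespace PlanarIndex

/-! ### The model dynamics -/

theorem IsPlusProfile.neg_one {c : ℝ → ℝ} (h : IsPlusProfile c) : c (-1) = 1 :=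
  (h.eq_one_iff _ (by simp)).2 (by simp)

theorem IsPlusProfile.one {c : ℝ → ℝ} (h : IsPlusProfile c) : c 1 = 1 :=
  (h.eq_one_iff _ (by simp)).2 (by simp)

theorem IsMinusProfile.neg_one {c : ℝ → ℝ} (h : IsMinusProfile c) : c (-1) = 1 :=
  (h.eq_one_iff _ (by simp)).2 (by simp)

theorem IsMinusProfile.one {c : ℝ → ℝ} (h : IsMinusProfile c) : c 1 = 1 :=
  (h.eq_one_iff _ (by simp)).2 (by simp)

/-- The common properties of the profiles `c₊` (for `σ = 1`) and `c₋` (for `σ = -1`). -/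
structure IsSignedProfile (σ : ℤ) (c : ℝ → ℝ) : Prop where
  continuousOn : ContinuousOn c (Icc (-1) 1)
  neg_one : c (-1) = 1
  one : c 1 = 1
  strictMonoOn : StrictMonoOn (fun s => s * c s) (Icc (-1) 1)
  pos : ∀ s ∈ Ioo (-1 : ℝ) 1, s ≠ 0 → 0 < (σ : ℝ) * (c s - 1)

theorem IsPlusProfile.isSignedProfile {c : ℝ → ℝ} (h : IsPlusProfile c) : IsSignedProfile 1 c where
  continuousOn := h.continuousOn
  neg_one := h.neg_one
  one := h.one
  strictMonoOn := h.strictMonoOn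
  pos s hs h0 := by
    have hs' := Ioo_subset_Icc_self hs
    have : c s ≠ 1 := fun h1 => by
      rcases (h.eq_one_iff s hs').1 h1 with h | h | h
      · exact hs.1.ne' h
      · exact h0 h
      · exact hs.2.ne h
    have := lt_of_le_of_ne (h.mapsTo hs').1 this.symm
    push_cast; linarith

theorem IsMinusProfile.isSignedProfile {c : ℝ → ℝ} (h : IsMinusProfile c) :
    IsSignedProfile (-1) c where
  continuousOn := h.continuousOn
  neg_one := h.neg_one
  one := h.one
  strictMonoOn := h.strictMonoOn
  pos s hs h0 := by
    have hs' := Ioo_subset_Icc_self hs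
    have : c s ≠ 1 := fun h1 => by
      rcases (h.eq_one_iff s hs').1 h1 with h | h | h
      · exact hs.1.ne' h
      · exact h0 h
      · exact hs.2.ne h
    have := lt_of_le_of_ne (h.mapsTo hs').2 this
    push_cast; linarith

theorem pieceCoord_mem (m : ℕ) (t : ℝ) : pieceCoord m t ∈ Ico (-1 : ℝ) 1 := by
  have := Int.fract_nonneg (m * t)
  have := Int.fract_lt_one (m * t)
  constructor <;> unfold pieceCoord <;> linarith

theorem IsSignedProfile.mul_mem {σ : ℤ} {c : ℝ → ℝ} (h : IsSignedProfile σ c) {s : ℝ}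
    (hs : s ∈ Ico (-1 : ℝ) 1) : s * c s ∈ Ico (-1 : ℝ) 1 := by
  have h1 := h.strictMonoOn.monotoneOn (left_mem_Icc.2 (by norm_num)) (Ico_subset_Icc_self hs) hs.1
  have h2 := h.strictMonoOn (Ico_subset_Icc_self hs) (right_mem_Icc.2 (by norm_num)) hs.2
  simp only [h.neg_one, h.one] at h1 h2
  constructor <;> linarith

/-- A piece has length 1/m and its coordinate has length 2, whence the factor 2m. The fixed points
and the direction of motion of the model are read off from this product. -/
theorem modelAngle_sub_self {m : ℕ} (hm : 0 < m) (c : ℝ → ℝ) (t : ℝ) :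
    modelAngle m c t - t = pieceCoord m t * (c (pieceCoord m t) - 1) / (2 * m) := by
  have hm' : (m : ℝ) ≠ 0 := by positivity
  have h1 : (⌊(m : ℝ) * t⌋ : ℝ) = m * t - (pieceCoord m t + 1) / 2 := by
    have := Int.floor_add_fract ((m : ℝ) * t)
    unfold pieceCoord; linarith
  rw [modelAngle, h1]
  field_simp
  ring

/-- Inside a piece this is the monotonicity of s·c(s); between pieces it holds because s·c(s) stays
in [-1,1), so every piece is mapped into itself. The formula is used on all of ℝ, which avoids
restricting to [0,1]. -/
theorem modelAngle_strictMono {m : ℕ} (hm : 0 < m) {σ : ℤ} {c : ℝ → ℝ}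
    (h : IsSignedProfile σ c) : StrictMono (modelAngle m c) := by
  intro t t' ht
  have hm' : (0 : ℝ) < m := by positivity
  have hlt : (m : ℝ) * t < m * t' := mul_lt_mul_of_pos_left ht hm'
  have hs := h.mul_mem (pieceCoord_mem m t)
  have hs' := h.mul_mem (pieceCoord_mem m t')
  refine div_lt_div_of_pos_right ?_ hm'
  rcases (Int.floor_le_floor hlt.le).lt_or_eq with hf | hf
  · have : (⌊(m : ℝ) * t⌋ : ℝ) + 1 ≤ ⌊(m : ℝ) * t'⌋ := by exact_mod_cast hf
    linarith [hs.2, hs'.1]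
  · have : pieceCoord m t < pieceCoord m t' := by
      simp only [pieceCoord, Int.fract, hf]; linarith
    have := h.strictMonoOn (Ico_subset_Icc_self (pieceCoord_mem m t))
      (Ico_subset_Icc_self (pieceCoord_mem m t')) this
    simp only at this
    rw [hf]; linarith

theorem modelAngle_surjective {m : ℕ} (hm : 0 < m) {σ : ℤ} {c : ℝ → ℝ}
    (h : IsSignedProfile σ c) : Function.Surjective (modelAngle m c) := by
  intro v
  have hm' : (m : ℝ) ≠ 0 := by positivity
  have hcont : ContinuousOn (fun s => s * c s) (Icc (-1) 1) := continuousOn_id.mul h.continuousOn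
  have hv0 := Int.fract_nonneg (m * v)
  have hv1 := Int.fract_lt_one (m * v)
  obtain ⟨s, hs, hsv⟩ := intermediate_value_Icc (by norm_num : (-1 : ℝ) ≤ 1) hcont
    (show 2 * Int.fract (m * v) - 1 ∈ Icc _ _ by
      simp only [h.neg_one, h.one]; constructor <;> linarith)
  simp only at hsv
  have hs1 : s < 1 := by
    refine lt_of_le_of_ne hs.2 fun h1 => ?_
    rw [h1, h.one] at hsv; linarith
  have hfl : ⌊(m : ℝ) * ((⌊m * v⌋ + (s + 1) / 2) / m)⌋ = ⌊m * v⌋ := by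
    rw [mul_div_cancel₀ _ hm', Int.floor_eq_iff]
    constructor <;> linarith [hs.1]
  have hp : pieceCoord m ((⌊m * v⌋ + (s + 1) / 2) / m) = s := by
    rw [pieceCoord, Int.fract, hfl, mul_div_cancel₀ _ hm']; ring
  refine ⟨(⌊m * v⌋ + (s + 1) / 2) / m, ?_⟩
  rw [modelAngle, hfl, hp, hsv]
  have := Int.floor_add_fract ((m : ℝ) * v)
  field_simp
  linarith

theorem modelAngle_zero {m : ℕ} {σ : ℤ} {c : ℝ → ℝ}
    (h : IsSignedProfile σ c) : modelAngle m c 0 = 0 := by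
  simp [modelAngle, pieceCoord, h.neg_one]

theorem modelAngle_one {m : ℕ} (hm : 0 < m) {σ : ℤ} {c : ℝ → ℝ}
    (h : IsSignedProfile σ c) : modelAngle m c 1 = 1 := by
  have hm' : (m : ℝ) ≠ 0 := by positivity
  simp [modelAngle, pieceCoord, h.neg_one, hm']

theorem continuous_modelRadial (m : ℕ) : Continuous (modelRadial m) := by
  -- The jumps of `Int.fract` are harmless, since the outer function takes the same value at 0 and
  -- 1.
  have : Continuous ((fun s : ℝ => 2 * (2 * s - 1) ^ 2 - 1) ∘ Int.fract) :=
    ContinuousOn.comp_fract'' (by fun_prop) (by norm_num)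
  exact this.comp (continuous_const_mul (m : ℝ))

theorem modelRadial_zero (m : ℕ) : modelRadial m 0 = 1 := by
  norm_num [modelRadial, pieceCoord]

theorem modelRadial_one (m : ℕ) : modelRadial m 1 = 1 := by
  norm_num [modelRadial, pieceCoord]

theorem abs_modelRadial_le (m : ℕ) (t : ℝ) : |modelRadial m t| ≤ 1 := by
  have h := pieceCoord_mem m t
  rw [abs_le, modelRadial]
  constructor <;> nlinarith [h.1, h.2]

/-- A fixed point of an iterate of the model is either an endpoint of a piece, where the radial
part is `1`, or the centre of a piece, where the radial part is `-1`. -/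
theorem modelAngle_iterate_fixed {m : ℕ} (hm : 0 < m) {σ : ℤ} {c : ℝ → ℝ}
    (h : IsSignedProfile σ c) {n : ℕ} (hn : 0 < n) {t : ℝ} (ht : (modelAngle m c)^[n] t = t) :
    modelAngle m c t = t ∧ (modelRadial m t = 1 ∨ pieceCoord m t = 0) := by
  have h1 : modelAngle m c t = t := by
    -- A monotone map of the line has no periodic points other than fixed points; this is obtained
    -- by comparing its iterates with those of the identity.
    have := (Function.Commute.id_right (f := modelAngle m c)).iterate_pos_eq_iff_map_eq
      (modelAngle_strictMono hm h).monotone strictMono_id hn (x := t)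
    simpa using this.1 (by simpa using ht)
  refine ⟨h1, ?_⟩
  have h2 := modelAngle_sub_self hm c t
  rw [h1, sub_self, eq_comm, div_eq_zero_iff] at h2
  have hm' : (2 * (m : ℝ)) ≠ 0 := by positivity
  rcases mul_eq_zero.1 (h2.resolve_right hm') with h3 | h3
  · exact Or.inr h3
  · by_cases h4 : pieceCoord m t = 0
    · exact Or.inr h4
    · left
      have h5 := pieceCoord_mem m t
      rcases h5.1.eq_or_lt with h6 | h6
      · rw [modelRadial, ← h6]; norm_num
      · have := h.pos _ ⟨h6, h5.2⟩ h4
        rw [h3] at this; simp at this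

/-- The centre of the `i`-th piece. -/
noncomputable def pieceCentre (m i : ℕ) : ℝ := (i + 1 / 2) / m

theorem pieceCentre_mem {m i : ℕ} (hi : i < m) : pieceCentre m i ∈ Ioo (0 : ℝ) 1 := by
  have h1 : (i : ℝ) + 1 ≤ m := by exact_mod_cast hi
  have h0 : (0 : ℝ) < m := by linarith [(Nat.cast_nonneg i : (0 : ℝ) ≤ i)]
  constructor
  · unfold pieceCentre; positivity
  · rw [pieceCentre, div_lt_one h0]; linarith

theorem floor_pieceCentre {m i : ℕ} (hi : i < m) : ⌊(m : ℝ) * pieceCentre m i⌋ = i := by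
  have h0 : (m : ℝ) ≠ 0 := Nat.cast_ne_zero.2 (by omega)
  rw [pieceCentre, mul_div_cancel₀ _ h0, Int.floor_eq_iff]
  constructor <;> push_cast <;> linarith

theorem pieceCoord_pieceCentre {m i : ℕ} (hi : i < m) : pieceCoord m (pieceCentre m i) = 0 := by
  have h0 : (m : ℝ) ≠ 0 := Nat.cast_ne_zero.2 (by omega)
  rw [pieceCoord, Int.fract, floor_pieceCentre hi, pieceCentre, mul_div_cancel₀ _ h0]
  push_cast; ring

theorem modelRadial_pieceCentre {m i : ℕ} (hi : i < m) : modelRadial m (pieceCentre m i) = -1 := by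
  rw [modelRadial, pieceCoord_pieceCentre hi]; norm_num

theorem modelAngle_pieceCentre {m i : ℕ} (hi : i < m) (c : ℝ → ℝ) :
    modelAngle m c (pieceCentre m i) = pieceCentre m i := by
  rw [← sub_eq_zero, modelAngle_sub_self (by omega), pieceCoord_pieceCentre hi]; simp

theorem exists_eq_pieceCentre {m : ℕ} (hm : 0 < m) {t : ℝ} (ht : t ∈ Icc (0 : ℝ) 1)
    (h : pieceCoord m t = 0) : ∃ i < m, t = pieceCentre m i := by
  have h0 : (0 : ℝ) < m := by positivity
  have hf : Int.fract ((m : ℝ) * t) = 1 / 2 := by unfold pieceCoord at h; linarith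
  have h1 := Int.floor_add_fract ((m : ℝ) * t)
  obtain ⟨i, hi⟩ := Int.eq_ofNat_of_zero_le (Int.floor_nonneg.2 (mul_nonneg h0.le ht.1))
  rw [hf, hi] at h1
  push_cast at h1
  refine ⟨i, ?_, ?_⟩
  · have : (i : ℝ) < m := by nlinarith [ht.2]
    exact_mod_cast this
  · rw [pieceCentre, h1]; field_simp

/-- Near the centre of a piece, the iterates of the model push points away from the centre if
`σ = 1` and towards it if `σ = -1`. -/
theorem modelAngle_iterate_near_centre {m : ℕ} {σ : ℤ} {c : ℝ → ℝ} (h : IsSignedProfile σ c)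
    (hσ : σ = 1 ∨ σ = -1) {n : ℕ} (hn : 0 < n) {i : ℕ} (hi : i < m) {t : ℝ}
    (ht : |t - pieceCentre m i| < 1 / (2 * m)) :
    (0 < (σ : ℝ) * (t - pieceCentre m i) → t < (modelAngle m c)^[n] t) ∧
    ((σ : ℝ) * (t - pieceCentre m i) < 0 → (modelAngle m c)^[n] t < t) := by
  have hm : 0 < m := by omega
  have h0 : (0 : ℝ) < m := by positivity
  have hs : pieceCoord m t = 2 * m * (t - pieceCentre m i) := by
    have hmt : (m : ℝ) * t = i + 1 / 2 + m * (t - pieceCentre m i) := by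
      unfold pieceCentre; field_simp; ring
    have hb : |(m : ℝ) * (t - pieceCentre m i)| < 1 / 2 := by
      rw [abs_mul, abs_of_pos h0]
      calc (m : ℝ) * |t - pieceCentre m i| < m * (1 / (2 * m)) := by gcongr
        _ = 1 / 2 := by field_simp
    rw [abs_lt] at hb
    have hfl : ⌊(m : ℝ) * t⌋ = i := by
      rw [Int.floor_eq_iff, hmt]; constructor <;> push_cast <;> linarith
    rw [pieceCoord, Int.fract, hfl, hmt]; push_cast; ring
  have hmem : pieceCoord m t ∈ Ioo (-1 : ℝ) 1 := by
    rw [abs_lt] at ht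
    have e : 2 * (m : ℝ) * (1 / (2 * m)) = 1 := by field_simp
    rw [hs]
    constructor <;> nlinarith
  have hpos : t ≠ pieceCentre m i → 0 < (σ : ℝ) * (c (pieceCoord m t) - 1) := fun hne =>
    h.pos _ hmem (by rw [hs]; have := sub_ne_zero.2 hne; positivity)
  have hsub := modelAngle_sub_self hm c t
  have hmono := modelAngle_strictMono hm h
  have hσ2 : (σ : ℝ) * σ = 1 := by rcases hσ with h | h <;> rw [h] <;> norm_num
  -- Since σ² = 1, σ can be inserted twice; the second factor is positive off the centre. The sign
  -- of one step then passes to n steps by monotonicity.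
  have key : modelAngle m c t - t =
      ((σ : ℝ) * (t - pieceCentre m i)) * ((σ : ℝ) * (c (pieceCoord m t) - 1)) := by
    rw [hsub]
    generalize c (pieceCoord m t) = C
    rw [hs]
    field_simp
    linear_combination (-(t - pieceCentre m i) * (C - 1)) * hσ2
  have hcomm : Function.Commute id (modelAngle m c) := Function.Commute.id_left
  constructor
  · intro hp
    have hne : t ≠ pieceCentre m i := fun e => by rw [e] at hp; simp at hp
    have := hcomm.iterate_pos_lt_iff_map_lt' strictMono_id hmono.monotone hn (x := t)
    simp only [id_eq, Function.iterate_id] at this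
    rw [this]
    have := mul_pos hp (hpos hne)
    linarith
  · intro hp
    have hne : t ≠ pieceCentre m i := fun e => by rw [e] at hp; simp at hp
    have := hcomm.symm.iterate_pos_lt_iff_map_lt hmono.monotone strictMono_id hn (x := t)
    simp only [id_eq, Function.iterate_id] at this
    rw [this]
    have := mul_neg_of_neg_of_pos hp (hpos hne)
    linarith

end PlanarIndex

namespace PlanarIndex

open Filter Topology

/-! ### The blow-up -/

theorem coe_two_mul (x : ℝ) : ((2 * x : ℝ) : UnitAddCircle) = doubling (x : UnitAddCircle) := by
  rw [doubling, ← AddCircle.coe_nsmul, nsmul_eq_mul, Nat.cast_ofNat]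

theorem coe_two_pow_mul (n : ℕ) (x : ℝ) :
    ((2 ^ n * x : ℝ) : UnitAddCircle) = doubling^[n] (x : UnitAddCircle) := by
  induction n with
  | zero => simp
  | succ n ih => rw [Function.iterate_succ_apply', ← ih, ← coe_two_mul, pow_succ']; ring_nf

theorem coe_add_int (x : ℝ) (k : ℤ) : ((x + k : ℝ) : UnitAddCircle) = x := by
  have hk : ((k : ℝ) : UnitAddCircle) = 0 := (AddCircle.coe_eq_zero_iff _).2 ⟨k, by simp⟩
  rw [AddCircle.coe_add, hk, add_zero]

theorem exists_int_of_coe_eq {x y : ℝ} (h : (x : UnitAddCircle) = y) : ∃ k : ℤ, x = y + k := by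
  rw [← sub_eq_zero, ← AddCircle.coe_sub, AddCircle.coe_eq_zero_iff] at h
  obtain ⟨k, hk⟩ := h
  exact ⟨k, by simp at hk; linarith⟩

namespace IsBlowUp

variable {q : CircleDeg1Lift} {B : Set UnitAddCircle}

theorem fibre_nonempty (hq : IsBlowUp q B) (x : ℝ) : (q ⁻¹' {x}).Nonempty :=
  q.continuous_iff_surjective.1 hq.continuous x

theorem fibre_isClosed (hq : IsBlowUp q B) (x : ℝ) : IsClosed (q ⁻¹' {x}) :=
  isClosed_singleton.preimage hq.continuous

theorem fibre_bddBelow (_hq : IsBlowUp q B) (x : ℝ) : BddBelow (q ⁻¹' {x}) := by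
  refine ⟨x - q 0 - 1, fun y hy => ?_⟩
  have h := q.map_le_of_map_zero y
  rw [show q y = x from hy] at h
  linarith [Int.ceil_lt_add_one y]

theorem fibre_bddAbove (_hq : IsBlowUp q B) (x : ℝ) : BddAbove (q ⁻¹' {x}) := by
  refine ⟨x - q 0 + 1, fun y hy => ?_⟩
  have h := q.le_map_of_map_zero y
  rw [show q y = x from hy] at h
  linarith [Int.lt_floor_add_one y]

theorem map_leftEnd (hq : IsBlowUp q B) (x : ℝ) : q (leftEnd q x) = x :=
  (hq.fibre_isClosed x).csInf_mem (hq.fibre_nonempty x) (hq.fibre_bddBelow x)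

theorem map_rightEnd (hq : IsBlowUp q B) (x : ℝ) : q (rightEnd q x) = x :=
  (hq.fibre_isClosed x).csSup_mem (hq.fibre_nonempty x) (hq.fibre_bddAbove x)

theorem map_eq_iff (hq : IsBlowUp q B) {x y : ℝ} :
    q y = x ↔ y ∈ Icc (leftEnd q x) (rightEnd q x) := by
  constructor
  · intro h
    exact ⟨csInf_le (hq.fibre_bddBelow x) h, le_csSup (hq.fibre_bddAbove x) h⟩
  · intro h
    refine le_antisymm ?_ ?_
    · exact (q.monotone h.2).trans_eq (hq.map_rightEnd x)
    · exact (hq.map_leftEnd x).symm.trans_le (q.monotone h.1)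

theorem mem_fibre (hq : IsBlowUp q B) (y : ℝ) : y ∈ Icc (leftEnd q (q y)) (rightEnd q (q y)) :=
  hq.map_eq_iff.1 rfl

theorem leftEnd_le_rightEnd (hq : IsBlowUp q B) (x : ℝ) : leftEnd q x ≤ rightEnd q x :=
  (hq.map_eq_iff.1 (hq.map_leftEnd x)).2

theorem leftEnd_lt_rightEnd_iff (hq : IsBlowUp q B) (x : ℝ) :
    leftEnd q x < rightEnd q x ↔ (x : UnitAddCircle) ∈ B := by
  rw [← hq.nontrivial_iff x]
  have : q ⁻¹' {x} = Icc (leftEnd q x) (rightEnd q x) := Set.ext fun y => hq.map_eq_iff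
  rw [this]
  refine ⟨fun h => ⟨_, left_mem_Icc.2 h.le, _, right_mem_Icc.2 h.le, h.ne⟩, ?_⟩
  rintro ⟨y, hy, z, hz, hyz⟩
  by_contra! hle
  exact hyz (by linarith [hy.1, hy.2, hz.1, hz.2])

theorem leftEnd_add_int (hq : IsBlowUp q B) (x : ℝ) (k : ℤ) :
    leftEnd q (x + k) = leftEnd q x + k := by
  apply le_antisymm
  · refine (hq.map_eq_iff.1 ?_).1
    rw [q.map_add_int, hq.map_leftEnd]
  · have : q (leftEnd q (x + k) - k) = x := by rw [q.map_sub_int, hq.map_leftEnd]; ring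
    linarith [(hq.map_eq_iff.1 this).1]

theorem rightEnd_add_int (hq : IsBlowUp q B) (x : ℝ) (k : ℤ) :
    rightEnd q (x + k) = rightEnd q x + k := by
  apply le_antisymm
  · have : q (rightEnd q (x + k) - k) = x := by rw [q.map_sub_int, hq.map_rightEnd]; ring
    linarith [(hq.map_eq_iff.1 this).2]
  · refine (hq.map_eq_iff.1 ?_).2
    rw [q.map_add_int, hq.map_rightEnd]

theorem rightEnd_le_leftEnd (hq : IsBlowUp q B) {x x' : ℝ} (h : x < x') :
    rightEnd q x ≤ leftEnd q x' := by
  by_contra! hlt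
  have := q.monotone hlt.le
  rw [hq.map_leftEnd, hq.map_rightEnd] at this
  linarith

theorem fibreCoord_mem (hq : IsBlowUp q B) (y : ℝ) : fibreCoord q y ∈ Icc (0 : ℝ) 1 := by
  have h := hq.mem_fibre y
  have h' := hq.leftEnd_le_rightEnd (q y)
  constructor
  · exact div_nonneg (by linarith [h.1]) (by linarith)
  · exact div_le_one_of_le₀ (by linarith [h.2]) (by linarith)

theorem leftEnd_add_mul_fibreCoord (hq : IsBlowUp q B) (y : ℝ) :
    leftEnd q (q y) + (rightEnd q (q y) - leftEnd q (q y)) * fibreCoord q y = y := by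
  have h := hq.mem_fibre y
  -- On a one-point fibre the coordinate is a division by 0, but it is multiplied by the zero
  -- length.
  rcases (hq.leftEnd_le_rightEnd (q y)).eq_or_lt with h' | h'
  · rw [← h'] at h ⊢
    linarith [h.1, h.2]
  · have : rightEnd q (q y) - leftEnd q (q y) ≠ 0 := by linarith
    rw [fibreCoord, mul_div_cancel₀ _ this]; ring

theorem fibreCoord_add_int (hq : IsBlowUp q B) (y : ℝ) (k : ℤ) :
    fibreCoord q (y + k) = fibreCoord q y := by
  simp only [fibreCoord, q.map_add_int, hq.leftEnd_add_int, hq.rightEnd_add_int]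
  congr 1 <;> ring

theorem map_leftEnd_add_mul (hq : IsBlowUp q B) (x : ℝ) {u : ℝ} (hu : u ∈ Icc (0 : ℝ) 1) :
    q (leftEnd q x + (rightEnd q x - leftEnd q x) * u) = x := by
  have := hq.leftEnd_le_rightEnd x
  rw [hq.map_eq_iff]
  constructor <;> nlinarith [hu.1, hu.2]

theorem fibreCoord_leftEnd_add_mul (hq : IsBlowUp q B) {x : ℝ} (hx : (x : UnitAddCircle) ∈ B)
    {u : ℝ} (hu : u ∈ Icc (0 : ℝ) 1) :
    fibreCoord q (leftEnd q x + (rightEnd q x - leftEnd q x) * u) = u := by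
  have h := (hq.leftEnd_lt_rightEnd_iff x).2 hx
  have h' : rightEnd q x - leftEnd q x ≠ 0 := by linarith
  rw [fibreCoord, hq.map_leftEnd_add_mul x hu, add_sub_cancel_left, mul_div_cancel_left₀ _ h']

end IsBlowUp

/-! ### The angular map -/

/-- Ensures that J_x and J_{2x} are both intervals or both points, so that affine coordinates can be
transported between them. -/
theorem backwardOrbit_doubling {Λ : Set UnitAddCircle} (hΛ : MapsTo doubling Λ Λ)
    {x : UnitAddCircle} : doubling x ∈ backwardOrbit Λ ↔ x ∈ backwardOrbit Λ := by
  constructor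
  · rintro ⟨k, hk⟩
    exact ⟨k + 1, by rwa [Function.iterate_succ_apply]⟩
  · rintro ⟨k, hk⟩
    refine ⟨k, ?_⟩
    rw [← Function.iterate_succ_apply, Function.iterate_succ_apply']
    exact hΛ hk

theorem subset_backwardOrbit (Λ : Set UnitAddCircle) : Λ ⊆ backwardOrbit Λ := fun _ hx => ⟨0, hx⟩

/-- The data from which the planar map is built. -/
structure IsPlanarData (a : ℕ → ℤ) (cPlus cMinus : ℝ → ℝ) (Λ : Set UnitAddCircle)
    (q : CircleDeg1Lift) : Prop where
  plus : IsPlusProfile cPlus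
  minus : IsMinusProfile cMinus
  family : IsOrbitFamily (modifiedPeriods a) Λ
  blowUp : IsBlowUp q (backwardOrbit Λ)

open Classical in
/-- The angular map in the affine coordinates of `J_α` and `J_{2α}`. -/
noncomputable def sectorMap (a : ℕ → ℤ) (cPlus cMinus : ℝ → ℝ) (Λ : Set UnitAddCircle)
    (α : UnitAddCircle) : ℝ → ℝ :=
  if α ∈ Λ then modelAngle (sectorCount a α) (sectorProfile a cPlus cMinus α) else id

theorem turns_ne_zero_iff {a : ℕ → ℤ} {k : ℕ} (hk : 0 < k) :
    turns a k ≠ 0 ↔ k ∈ modifiedPeriods a := by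
  unfold turns modifiedPeriods
  by_cases h : k = 1
  · subst h; simp [sub_eq_zero]
  · have : 2 ≤ k := by omega
    simp [h, this]

namespace IsPlanarData

variable {a : ℕ → ℤ} {cPlus cMinus : ℝ → ℝ} {Λ : Set UnitAddCircle} {q : CircleDeg1Lift}

theorem minimalPeriod_pos (h : IsPlanarData a cPlus cMinus Λ q) {α : UnitAddCircle} (hα : α ∈ Λ) :
    0 < Function.minimalPeriod doubling α :=
  Function.minimalPeriod_pos_of_mem_periodicPts (h.family.periodic hα)

theorem turns_ne_zero (h : IsPlanarData a cPlus cMinus Λ q) {α : UnitAddCircle} (hα : α ∈ Λ) :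
    turns a (Function.minimalPeriod doubling α) ≠ 0 :=
  (turns_ne_zero_iff (h.minimalPeriod_pos hα)).2 (h.family.periods ▸ mem_image_of_mem _ hα)

theorem sectorCount_pos (h : IsPlanarData a cPlus cMinus Λ q) {α : UnitAddCircle} (hα : α ∈ Λ) :
    0 < sectorCount a α :=
  Int.natAbs_pos.2 (h.turns_ne_zero hα)

theorem isSignedProfile (h : IsPlanarData a cPlus cMinus Λ q) {α : UnitAddCircle} (hα : α ∈ Λ) :
    IsSignedProfile (turns a (Function.minimalPeriod doubling α)).sign
      (sectorProfile a cPlus cMinus α) := by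
  unfold sectorProfile
  split_ifs with h1
  · rw [Int.sign_eq_one_of_pos h1]
    exact h.plus.isSignedProfile
  · rw [Int.sign_eq_neg_one_of_neg (lt_of_le_of_ne (not_lt.1 h1) (h.turns_ne_zero hα))]
    exact h.minus.isSignedProfile

theorem sectorMap_of_mem {α : UnitAddCircle} (hα : α ∈ Λ) :
    sectorMap a cPlus cMinus Λ α =
      modelAngle (sectorCount a α) (sectorProfile a cPlus cMinus α) := by
  rw [sectorMap, if_pos hα]

theorem sectorMap_strictMono (h : IsPlanarData a cPlus cMinus Λ q) (α : UnitAddCircle) :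
    StrictMono (sectorMap a cPlus cMinus Λ α) := by
  unfold sectorMap
  split_ifs with hα
  · exact modelAngle_strictMono (h.sectorCount_pos hα) (h.isSignedProfile hα)
  · exact strictMono_id

theorem sectorMap_surjective (h : IsPlanarData a cPlus cMinus Λ q) (α : UnitAddCircle) :
    Function.Surjective (sectorMap a cPlus cMinus Λ α) := by
  unfold sectorMap
  split_ifs with hα
  · exact modelAngle_surjective (h.sectorCount_pos hα) (h.isSignedProfile hα)
  · exact Function.surjective_id

theorem sectorMap_mem_iff (h : IsPlanarData a cPlus cMinus Λ q) (α : UnitAddCircle) {u : ℝ} :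
    sectorMap a cPlus cMinus Λ α u ∈ Icc (0 : ℝ) 1 ↔ u ∈ Icc (0 : ℝ) 1 := by
  have h0 : sectorMap a cPlus cMinus Λ α 0 = 0 := by
    unfold sectorMap
    split_ifs with hα
    · exact modelAngle_zero (h.isSignedProfile hα)
    · rfl
  have h1 : sectorMap a cPlus cMinus Λ α 1 = 1 := by
    unfold sectorMap
    split_ifs with hα
    · exact modelAngle_one (h.sectorCount_pos hα) (h.isSignedProfile hα)
    · rfl
  have hm := h.sectorMap_strictMono α
  rw [mem_Icc, mem_Icc, ← hm.le_iff_le (a := 0) (b := u), ← hm.le_iff_le (a := u) (b := 1), h0, h1]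

/-- The model depends only on the period, which is constant along an orbit; hence hⁿ acts in the
sectors over Λ as the n-th iterate of a single model. -/
theorem sectorMap_doubling (h : IsPlanarData a cPlus cMinus Λ q) {α : UnitAddCircle}
    (hα : α ∈ Λ) :
    sectorMap a cPlus cMinus Λ (doubling α) = sectorMap a cPlus cMinus Λ α := by
  rw [sectorMap_of_mem hα, sectorMap_of_mem (h.family.invariant hα), sectorCount, sectorProfile,
    Function.minimalPeriod_apply (h.family.periodic hα), sectorCount, sectorProfile]

theorem sectorCount_doubling (h : IsPlanarData a cPlus cMinus Λ q) {α : UnitAddCircle}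
    (hα : α ∈ Λ) : sectorCount a (doubling α) = sectorCount a α := by
  rw [sectorCount, Function.minimalPeriod_apply (h.family.periodic hα), sectorCount]

theorem angularMap_eq (y : ℝ) : angularMap a cPlus cMinus Λ q y =
    leftEnd q (2 * q y) + (rightEnd q (2 * q y) - leftEnd q (2 * q y)) *
      sectorMap a cPlus cMinus Λ (q y : UnitAddCircle) (fibreCoord q y) := by
  unfold angularMap sectorMap
  split_ifs <;> rfl

theorem map_angularMap (h : IsPlanarData a cPlus cMinus Λ q) (y : ℝ) :
    q (angularMap a cPlus cMinus Λ q y) = 2 * q y := by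
  rw [angularMap_eq]
  exact h.blowUp.map_leftEnd_add_mul _
    ((h.sectorMap_mem_iff _).2 (h.blowUp.fibreCoord_mem y))

theorem fibreCoord_angularMap (h : IsPlanarData a cPlus cMinus Λ q) {y : ℝ}
    (hy : (q y : UnitAddCircle) ∈ backwardOrbit Λ) :
    fibreCoord q (angularMap a cPlus cMinus Λ q y) =
      sectorMap a cPlus cMinus Λ (q y : UnitAddCircle) (fibreCoord q y) := by
  rw [angularMap_eq]
  refine h.blowUp.fibreCoord_leftEnd_add_mul ?_
    ((h.sectorMap_mem_iff _).2 (h.blowUp.fibreCoord_mem y))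
  rw [coe_two_mul]
  exact (backwardOrbit_doubling h.family.invariant).2 hy

theorem angularMap_add_int (h : IsPlanarData a cPlus cMinus Λ q) (y : ℝ) (k : ℤ) :
    angularMap a cPlus cMinus Λ q (y + k) =
      angularMap a cPlus cMinus Λ q y + ((2 * k : ℤ) : ℝ) := by
  have e : (2 * (q y + k) : ℝ) = 2 * q y + ((2 * k : ℤ) : ℝ) := by push_cast; ring
  rw [angularMap_eq, angularMap_eq, CircleDeg1Lift.map_add_int, h.blowUp.fibreCoord_add_int, e,
    h.blowUp.leftEnd_add_int, h.blowUp.rightEnd_add_int, coe_add_int]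
  ring

/-- Within a fibre the sector map is increasing; distinct fibres are ordered like their base points,
and doubling on ℝ preserves that order. -/
theorem angularMap_monotone (h : IsPlanarData a cPlus cMinus Λ q) :
    Monotone (angularMap a cPlus cMinus Λ q) := by
  intro y y' hy
  rcases (q.monotone hy).eq_or_lt with hq | hq
  · rw [angularMap_eq, angularMap_eq, ← hq]
    have h1 := h.blowUp.leftEnd_le_rightEnd (2 * q y)
    have h2 : fibreCoord q y ≤ fibreCoord q y' := by
      rw [fibreCoord, fibreCoord, ← hq]
      exact div_le_div_of_nonneg_right (by linarith)
        (by linarith [h.blowUp.leftEnd_le_rightEnd (q y)])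
    have h3 := (h.sectorMap_strictMono (q y : UnitAddCircle)).monotone h2
    have h4 : 0 ≤ rightEnd q (2 * q y) - leftEnd q (2 * q y) := by linarith
    gcongr
  · have h1 := (h.blowUp.map_eq_iff.1 (h.map_angularMap y)).2
    have h2 := (h.blowUp.map_eq_iff.1 (h.map_angularMap y')).1
    have h3 := h.blowUp.rightEnd_le_leftEnd (show 2 * q y < 2 * q y' by linarith)
    linarith

theorem angularMap_surjective (h : IsPlanarData a cPlus cMinus Λ q) :
    Function.Surjective (angularMap a cPlus cMinus Λ q) := by
  intro z
  by_cases hx : ((q z / 2 : ℝ) : UnitAddCircle) ∈ backwardOrbit Λ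
  · obtain ⟨v, hv⟩ := h.sectorMap_surjective ((q z / 2 : ℝ) : UnitAddCircle) (fibreCoord q z)
    have hv' : v ∈ Icc (0 : ℝ) 1 := by
      rw [← h.sectorMap_mem_iff ((q z / 2 : ℝ) : UnitAddCircle), hv]
      exact h.blowUp.fibreCoord_mem z
    refine ⟨leftEnd q (q z / 2) + (rightEnd q (q z / 2) - leftEnd q (q z / 2)) * v, ?_⟩
    rw [angularMap_eq, h.blowUp.map_leftEnd_add_mul _ hv',
      h.blowUp.fibreCoord_leftEnd_add_mul hx hv', hv, mul_div_cancel₀ _ two_ne_zero]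
    exact h.blowUp.leftEnd_add_mul_fibreCoord z
  · refine ⟨leftEnd q (q z / 2), ?_⟩
    have hz : (q z : UnitAddCircle) ∉ backwardOrbit Λ := by
      rwa [← backwardOrbit_doubling h.family.invariant, ← coe_two_mul,
        mul_div_cancel₀ _ two_ne_zero] at hx
    have h1 := h.blowUp.mem_fibre z
    have h2 : leftEnd q (q z) = rightEnd q (q z) :=
      (h.blowUp.leftEnd_le_rightEnd _).eq_of_not_lt
        (mt (h.blowUp.leftEnd_lt_rightEnd_iff _).1 hz)
    rw [angularMap_eq, h.blowUp.map_leftEnd, mul_div_cancel₀ _ two_ne_zero, ← h2]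
    rw [← h2] at h1
    linarith [h1.1, h1.2]

/-- A monotone surjection of the line cannot jump, so no local analysis is needed where the blown-up
intervals accumulate. -/
theorem continuous_angularMap (h : IsPlanarData a cPlus cMinus Λ q) :
    Continuous (angularMap a cPlus cMinus Λ q) :=
  h.angularMap_monotone.continuous_of_surjective h.angularMap_surjective

theorem map_angularMap_iterate (h : IsPlanarData a cPlus cMinus Λ q) (n : ℕ) (y : ℝ) :
    q ((angularMap a cPlus cMinus Λ q)^[n] y) = 2 ^ n * q y := by
  induction n with
  | zero => simp
  | succ n ih => rw [Function.iterate_succ_apply', h.map_angularMap, ih]; ring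

theorem coe_map_angularMap_iterate (h : IsPlanarData a cPlus cMinus Λ q) (n : ℕ) (y : ℝ) :
    (q ((angularMap a cPlus cMinus Λ q)^[n] y) : UnitAddCircle) =
      doubling^[n] (q y : UnitAddCircle) := by
  rw [h.map_angularMap_iterate, coe_two_pow_mul]

theorem angularMap_iterate_add_int (h : IsPlanarData a cPlus cMinus Λ q) (n : ℕ) (y : ℝ) (k : ℤ) :
    (angularMap a cPlus cMinus Λ q)^[n] (y + k) =
      (angularMap a cPlus cMinus Λ q)^[n] y + ((2 ^ n * k : ℤ) : ℝ) := by
  induction n with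
  | zero => simp
  | succ n ih =>
    rw [Function.iterate_succ_apply', ih, h.angularMap_add_int, Function.iterate_succ_apply']
    push_cast; ring

theorem sector_iterate (h : IsPlanarData a cPlus cMinus Λ q) {α : UnitAddCircle} (hα : α ∈ Λ)
    (n : ℕ) : doubling^[n] α ∈ Λ ∧
      sectorMap a cPlus cMinus Λ (doubling^[n] α) = sectorMap a cPlus cMinus Λ α ∧
      sectorCount a (doubling^[n] α) = sectorCount a α := by
  induction n with
  | zero => exact ⟨hα, rfl, rfl⟩
  | succ n ih =>
    rw [Function.iterate_succ_apply']
    exact ⟨h.family.invariant ih.1, by rw [h.sectorMap_doubling ih.1, ih.2.1],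
      by rw [h.sectorCount_doubling ih.1, ih.2.2]⟩

theorem fibreCoord_angularMap_iterate (h : IsPlanarData a cPlus cMinus Λ q) {y : ℝ}
    (hy : (q y : UnitAddCircle) ∈ Λ) (n : ℕ) :
    fibreCoord q ((angularMap a cPlus cMinus Λ q)^[n] y) =
      (sectorMap a cPlus cMinus Λ (q y : UnitAddCircle))^[n] (fibreCoord q y) := by
  induction n with
  | zero => rfl
  | succ n ih =>
    have h1 := h.sector_iterate hy n
    rw [Function.iterate_succ_apply', Function.iterate_succ_apply', h.fibreCoord_angularMap,
      h.coe_map_angularMap_iterate, h1.2.1, ih]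
    rw [h.coe_map_angularMap_iterate]
    exact subset_backwardOrbit Λ h1.1

/-- The displacement of an iterate in a periodic sector. -/
theorem angularMap_iterate_sub_self (h : IsPlanarData a cPlus cMinus Λ q) {y : ℝ}
    (hy : (q y : UnitAddCircle) ∈ Λ) {n : ℕ} {k : ℤ} (hk : 2 ^ n * q y = q y + k) :
    (angularMap a cPlus cMinus Λ q)^[n] y - y = k + (rightEnd q (q y) - leftEnd q (q y)) *
      ((sectorMap a cPlus cMinus Λ (q y : UnitAddCircle))^[n] (fibreCoord q y) -
        fibreCoord q y) := by
  have h1 := h.blowUp.leftEnd_add_mul_fibreCoord ((angularMap a cPlus cMinus Λ q)^[n] y)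
  rw [h.map_angularMap_iterate, hk, h.blowUp.leftEnd_add_int, h.blowUp.rightEnd_add_int,
    h.fibreCoord_angularMap_iterate hy] at h1
  have h2 := h.blowUp.leftEnd_add_mul_fibreCoord y
  linear_combination h2 - h1

end IsPlanarData

end PlanarIndex

namespace PlanarIndex

open Filter Topology

/-! ### The radial map -/

theorem continuous_baseRadial (Λ : Set UnitAddCircle) : Continuous (baseRadial Λ) := by
  unfold baseRadial
  split_ifs
  · exact continuous_const
  · exact Metric.continuous_infDist_pt _

theorem baseRadial_nonneg (Λ : Set UnitAddCircle) (x : UnitAddCircle) : 0 ≤ baseRadial Λ x := by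
  unfold baseRadial
  split_ifs
  · exact zero_le_one
  · exact Metric.infDist_nonneg

theorem baseRadial_eq_zero {Λ : Set UnitAddCircle} {x : UnitAddCircle} (hx : x ∈ derivedSet Λ) :
    baseRadial Λ x = 0 := by
  rw [baseRadial, if_neg (nonempty_of_mem hx).ne_empty, Metric.infDist_zero_of_mem hx]

theorem baseRadial_pos {Λ : Set UnitAddCircle} {x : UnitAddCircle} (hx : x ∉ derivedSet Λ) :
    0 < baseRadial Λ x := by
  unfold baseRadial
  split_ifs with h
  · exact zero_lt_one
  · exact ((isClosed_derivedSet Λ).notMem_iff_infDist_pos (nonempty_iff_ne_empty.2 h)).1 hx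

theorem eventually_eq_of_notMem_derivedSet {Λ : Set UnitAddCircle} {x : UnitAddCircle}
    (hx : x ∉ derivedSet Λ) : ∀ᶠ z in 𝓝 x, z ∈ Λ → z = x := by
  rw [mem_derivedSet, accPt_iff_frequently, not_frequently] at hx
  filter_upwards [hx] with z hz hzΛ
  by_contra h
  exact hz ⟨h, hzΛ⟩

theorem abs_radialMap_le (a : ℕ → ℤ) (Λ : Set UnitAddCircle) (q : CircleDeg1Lift) (y : ℝ) :
    |radialMap a Λ q y| ≤ baseRadial Λ (q y : UnitAddCircle) := by
  unfold radialMap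
  rw [abs_mul, abs_of_nonneg (baseRadial_nonneg _ _)]
  refine mul_le_of_le_one_right (baseRadial_nonneg _ _) ?_
  split_ifs
  · exact abs_modelRadial_le _ _
  · simp

theorem exists_abs_radialMap_le (a : ℕ → ℤ) (Λ : Set UnitAddCircle) (q : CircleDeg1Lift) :
    ∃ C, ∀ y, |radialMap a Λ q y| ≤ C := by
  obtain ⟨C, hC⟩ := (isCompact_range (continuous_baseRadial Λ)).bddAbove
  exact ⟨C, fun y => (abs_radialMap_le a Λ q y).trans (hC (mem_range_self _))⟩

namespace IsPlanarData

variable {a : ℕ → ℤ} {cPlus cMinus : ℝ → ℝ} {Λ : Set UnitAddCircle} {q : CircleDeg1Lift}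

theorem radialMap_add_int (h : IsPlanarData a cPlus cMinus Λ q) (y : ℝ) (k : ℤ) :
    radialMap a Λ q (y + k) = radialMap a Λ q y := by
  unfold radialMap
  rw [q.map_add_int, coe_add_int, h.blowUp.fibreCoord_add_int]

theorem continuous_coe_map (h : IsPlanarData a cPlus cMinus Λ q) :
    Continuous fun y : ℝ => (q y : UnitAddCircle) :=
  (AddCircle.continuous_mk' 1).comp h.blowUp.continuous

/-- Over Λ' the bound |g| ≤ g₀ forces the limit 0. Elsewhere at most one point of Λ is near the base
point, so g is locally either g₀ or one scaled model extended by g₀. -/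
theorem continuous_radialMap (h : IsPlanarData a cPlus cMinus Λ q) :
    Continuous (radialMap a Λ q) := by
  have hg : Continuous fun y : ℝ => baseRadial Λ (q y : UnitAddCircle) :=
    (continuous_baseRadial Λ).comp h.continuous_coe_map
  rw [continuous_iff_continuousAt]
  intro y
  by_cases hy : (q y : UnitAddCircle) ∈ derivedSet Λ
  · have h0 : radialMap a Λ q y = 0 := by rw [radialMap, baseRadial_eq_zero hy, zero_mul]
    have h1 : Tendsto (fun y : ℝ => baseRadial Λ (q y : UnitAddCircle)) (𝓝 y) (𝓝 0) := by
      have := hg.tendsto y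
      rwa [baseRadial_eq_zero hy] at this
    rw [ContinuousAt, h0]
    exact squeeze_zero_norm (fun z => abs_radialMap_le a Λ q z) h1
  · have hev1 : ∀ᶠ z in 𝓝 y, (q z : UnitAddCircle) ∈ Λ →
        (q z : UnitAddCircle) = (q y : UnitAddCircle) :=
      h.continuous_coe_map.continuousAt.eventually (eventually_eq_of_notMem_derivedSet hy)
    by_cases hyΛ : (q y : UnitAddCircle) ∈ Λ
    -- Equality on the circle gives equality of lifts only up to an integer; this bound makes the
    -- integer 0.
    · have hev2 : ∀ᶠ z in 𝓝 y, |q z - q y| < 1 := by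
        have hc := h.blowUp.continuous
        have : ContinuousAt (fun z => |q z - q y|) y := by fun_prop
        exact this.eventually (gt_mem_nhds (by simp))
      have hlt := (h.blowUp.leftEnd_lt_rightEnd_iff (q y)).2 (subset_backwardOrbit Λ hyΛ)
      have hpos : 0 < rightEnd q (q y) - leftEnd q (q y) := sub_pos.2 hlt
      -- Clamping the coordinate to [0,1] merges both sides of the sector into one formula, because
      -- the radial model is 1 at 0 and at 1.
      have hc : Continuous fun z : ℝ => baseRadial Λ (q z : UnitAddCircle) *
          modelRadial (sectorCount a (q y : UnitAddCircle))
            (max 0 (min 1 ((z - leftEnd q (q y)) / (rightEnd q (q y) - leftEnd q (q y))))) :=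
        hg.mul ((continuous_modelRadial _).comp (by fun_prop))
      refine hc.continuousAt.congr ?_
      filter_upwards [hev1, hev2] with z hz1 hz2
      unfold radialMap
      congr 1
      split_ifs with hzΛ
      · have hqz : q z = q y := by
          obtain ⟨k, hk⟩ := exists_int_of_coe_eq (hz1 hzΛ)
          rw [hk, add_sub_cancel_left] at hz2
          have : k = 0 := Int.abs_lt_one_iff.1 (by exact_mod_cast hz2)
          simp [hk, this]
        have := h.blowUp.fibreCoord_mem z
        rw [fibreCoord, hqz] at this
        rw [fibreCoord, hqz, min_eq_right this.2, max_eq_right this.1]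
      · have hqz : ¬ q z = q y := fun e => hzΛ (e ▸ hyΛ)
        rw [h.blowUp.map_eq_iff, mem_Icc, not_and_or, not_le, not_le] at hqz
        rcases hqz with hqz | hqz
        · have : (z - leftEnd q (q y)) / (rightEnd q (q y) - leftEnd q (q y)) ≤ 0 :=
            div_nonpos_of_nonpos_of_nonneg (by linarith) hpos.le
          rw [max_eq_left ((min_le_right _ _).trans this), modelRadial_zero]
        · have : 1 ≤ (z - leftEnd q (q y)) / (rightEnd q (q y) - leftEnd q (q y)) := by
            rw [le_div_iff₀ hpos]; linarith
          rw [min_eq_left this, max_eq_right zero_le_one, modelRadial_one]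
    · refine hg.continuousAt.congr ?_
      filter_upwards [hev1] with z hz
      have : (q z : UnitAddCircle) ∉ Λ := fun hz' => hyΛ (hz hz' ▸ hz')
      rw [radialMap, if_neg this, mul_one]

/-- A periodic point off `Λ` has its whole orbit off `Λ`. -/
theorem iterate_notMem (h : IsPlanarData a cPlus cMinus Λ q) {x : UnitAddCircle} {n : ℕ}
    (hn : 0 < n) (hx : doubling^[n] x = x) (hxΛ : x ∉ Λ) (j : ℕ) : doubling^[j] x ∉ Λ := by
  intro hj
  -- As j ≤ n·j, the orbit returns to x after its j-th point, and forward invariance would carry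
  -- membership in Λ along to x.
  have h1 : doubling^[n * j] x = x :=
    Function.IsPeriodicPt.mul_const (show Function.IsPeriodicPt doubling n x from hx) j
  have h2 : j ≤ n * j := Nat.le_mul_of_pos_left j hn
  rw [← Nat.sub_add_cancel h2, Function.iterate_add_apply] at h1
  exact hxΛ (h1 ▸ h.family.invariant.iterate _ hj)

/-- The points of a periodic orbit are periodic, hence outside Λ', where g₀ vanishes. -/
theorem baseRadial_iterate_pos (h : IsPlanarData a cPlus cMinus Λ q) {x : UnitAddCircle} {n : ℕ}
    (hn : 0 < n) (hx : doubling^[n] x = x) (j : ℕ) : 0 < baseRadial Λ (doubling^[j] x) := by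
  refine baseRadial_pos fun hmem => h.family.derived.le_bot ⟨hmem, n, hn, ?_⟩
  exact (show Function.IsPeriodicPt doubling n x from hx).apply_iterate j

/-- The radial displacement of the iterates. -/
noncomputable def _root_.PlanarIndex.radialSum (a : ℕ → ℤ) (cPlus cMinus : ℝ → ℝ)
    (Λ : Set UnitAddCircle) (q : CircleDeg1Lift) (n : ℕ) (y : ℝ) : ℝ :=
  ∑ j ∈ Finset.range n, radialMap a Λ q ((angularMap a cPlus cMinus Λ q)^[j] y)

theorem continuous_radialSum (h : IsPlanarData a cPlus cMinus Λ q) (n : ℕ) :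
    Continuous (radialSum a cPlus cMinus Λ q n) :=
  continuous_finsetSum _ fun j _ => h.continuous_radialMap.comp
    (h.continuous_angularMap.iterate j)

theorem radialSum_add_int (h : IsPlanarData a cPlus cMinus Λ q) (n : ℕ) (y : ℝ) (k : ℤ) :
    radialSum a cPlus cMinus Λ q n (y + k) = radialSum a cPlus cMinus Λ q n y := by
  unfold radialSum
  refine Finset.sum_congr rfl fun j _ => ?_
  rw [h.angularMap_iterate_add_int, h.radialMap_add_int]

theorem radialMap_iterate_of_mem (h : IsPlanarData a cPlus cMinus Λ q) {y : ℝ}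
    (hy : (q y : UnitAddCircle) ∈ Λ) (j : ℕ)
    (hfix : sectorMap a cPlus cMinus Λ (q y : UnitAddCircle) (fibreCoord q y) =
      fibreCoord q y) :
    radialMap a Λ q ((angularMap a cPlus cMinus Λ q)^[j] y) =
      baseRadial Λ (doubling^[j] (q y : UnitAddCircle)) *
        modelRadial (sectorCount a (q y : UnitAddCircle)) (fibreCoord q y) := by
  have hj := h.sector_iterate hy j
  rw [radialMap, h.coe_map_angularMap_iterate, if_pos hj.1, hj.2.2,
    h.fibreCoord_angularMap_iterate hy, Function.iterate_fixed hfix]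

theorem radialSum_neg (h : IsPlanarData a cPlus cMinus Λ q) {y : ℝ}
    (hy : (q y : UnitAddCircle) ∈ Λ) {n : ℕ} (hn : 0 < n)
    (hper : doubling^[n] (q y : UnitAddCircle) = (q y : UnitAddCircle))
    {i : ℕ} (hi : i < sectorCount a (q y : UnitAddCircle))
    (hc : fibreCoord q y = pieceCentre (sectorCount a (q y : UnitAddCircle)) i) :
    radialSum a cPlus cMinus Λ q n y < 0 := by
  refine Finset.sum_neg (fun j _ => ?_) (Finset.nonempty_range_iff.2 hn.ne')
  rw [h.radialMap_iterate_of_mem hy, hc, modelRadial_pieceCentre hi]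
  · linarith [h.baseRadial_iterate_pos hn hper j]
  · rw [sectorMap_of_mem hy, hc, modelAngle_pieceCentre hi]

/-- At the fixed directions of an iterate, the radial displacement is positive except at the
centres of the pieces of the periodic sectors. -/
theorem radialSum_pos_or (h : IsPlanarData a cPlus cMinus Λ q) {n : ℕ} (hn : 0 < n) {y : ℝ}
    {k : ℤ} (hk : (angularMap a cPlus cMinus Λ q)^[n] y = y + k) :
    doubling^[n] (q y : UnitAddCircle) = (q y : UnitAddCircle) ∧
    (0 < radialSum a cPlus cMinus Λ q n y ∨ (q y : UnitAddCircle) ∈ Λ ∧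
      ∃ i < sectorCount a (q y : UnitAddCircle),
        fibreCoord q y = pieceCentre (sectorCount a (q y : UnitAddCircle)) i) := by
  have hk' : 2 ^ n * q y = q y + k := by
    rw [← h.map_angularMap_iterate, hk, q.map_add_int]
  have hper : doubling^[n] (q y : UnitAddCircle) = (q y : UnitAddCircle) := by
    rw [← coe_two_pow_mul, hk', coe_add_int]
  refine ⟨hper, ?_⟩
  by_cases hy : (q y : UnitAddCircle) ∈ Λ
  · have h1 := h.angularMap_iterate_sub_self hy hk'
    have hlt := (h.blowUp.leftEnd_lt_rightEnd_iff (q y)).2 (subset_backwardOrbit Λ hy)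
    rw [hk, add_sub_cancel_left, left_eq_add, mul_eq_zero, sub_eq_zero, sub_eq_zero] at h1
    have h2 := h1.resolve_left hlt.ne'
    rw [sectorMap_of_mem hy] at h2
    obtain ⟨h3, h4 | h4⟩ := modelAngle_iterate_fixed (h.sectorCount_pos hy)
      (h.isSignedProfile hy) hn h2
    · left
      refine Finset.sum_pos (fun j _ => ?_) (Finset.nonempty_range_iff.2 hn.ne')
      rw [h.radialMap_iterate_of_mem hy _ (by rw [sectorMap_of_mem hy, h3]), h4, mul_one]
      exact h.baseRadial_iterate_pos hn hper j
    · exact Or.inr ⟨hy, exists_eq_pieceCentre (h.sectorCount_pos hy) (h.blowUp.fibreCoord_mem y) h4⟩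
  · left
    refine Finset.sum_pos (fun j _ => ?_) (Finset.nonempty_range_iff.2 hn.ne')
    rw [radialMap, h.coe_map_angularMap_iterate, if_neg (h.iterate_notMem hn hper hy j), mul_one]
    exact h.baseRadial_iterate_pos hn hper j

end IsPlanarData

end PlanarIndex

namespace PlanarIndex

open Filter Topology

/-! ### The planar map in logarithmic coordinates -/

/-- The planar map in the coordinate `r + 2 π i θ`. -/
noncomputable def logMap (a : ℕ → ℤ) (cPlus cMinus : ℝ → ℝ) (Λ : Set UnitAddCircle)
    (q : CircleDeg1Lift) (ζ : ℂ) : ℂ :=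
  ((ζ.re - radialMap a Λ q (ζ.im / (2 * Real.pi)) : ℝ) : ℂ) +
    2 * Real.pi * angularMap a cPlus cMinus Λ q (ζ.im / (2 * Real.pi)) * Complex.I

namespace IsPlanarData

variable {a : ℕ → ℤ} {cPlus cMinus : ℝ → ℝ} {Λ : Set UnitAddCircle} {q : CircleDeg1Lift}

theorem continuous_logMap (h : IsPlanarData a cPlus cMinus Λ q) :
    Continuous (logMap a cPlus cMinus Λ q) := by
  have := h.continuous_radialMap
  have := h.continuous_angularMap
  unfold logMap
  fun_prop

/-- Replacing the principal argument by another angle changes θ by an integer k; then g is unchanged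
and the lift of h moves by 2k, which the exponential does not see. -/
theorem planarMap_exp (h : IsPlanarData a cPlus cMinus Λ q) (ζ : ℂ) :
    planarMap a cPlus cMinus Λ q (Complex.exp ζ) =
      Complex.exp (logMap a cPlus cMinus Λ q ζ) := by
  have hpi : (2 * Real.pi : ℝ) ≠ 0 := by positivity
  have hnorm : ‖Complex.exp ζ‖ = Real.exp ζ.re := Complex.norm_exp ζ
  obtain ⟨k, hk⟩ : ∃ k : ℤ, (Complex.exp ζ).arg / (2 * Real.pi) = ζ.im / (2 * Real.pi) + k := by
    have h1 := Complex.norm_mul_exp_arg_mul_I (Complex.exp ζ)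
    rw [hnorm, Complex.ofReal_exp, ← Complex.exp_add, Complex.exp_eq_exp_iff_exists_int] at h1
    obtain ⟨k, hk⟩ := h1
    have h2 := congrArg Complex.im hk
    refine ⟨k, ?_⟩
    simp at h2
    field_simp
    linarith
  rw [planarMap, if_neg (Complex.exp_ne_zero ζ), hk, h.radialMap_add_int, h.angularMap_add_int,
    hnorm, Real.log_exp, Complex.ofReal_exp, ← Complex.exp_add, logMap,
    Complex.exp_eq_exp_iff_exists_int]
  refine ⟨2 * k, ?_⟩
  push_cast; ring

/-- At 0, boundedness of g gives |f(z)| ≤ e^C |z|. Elsewhere one of two branches of the logarithm,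
log z or log(-z) + πi, is continuous. -/
theorem continuous_planarMap (h : IsPlanarData a cPlus cMinus Λ q) :
    Continuous (planarMap a cPlus cMinus Λ q) := by
  rw [continuous_iff_continuousAt]
  intro z
  rcases eq_or_ne z 0 with rfl | hz
  · obtain ⟨C, hC⟩ := exists_abs_radialMap_le a Λ q
    have h0 : planarMap a cPlus cMinus Λ q 0 = 0 := by rw [planarMap, if_pos rfl]
    rw [ContinuousAt, h0]
    have hb : ∀ z, ‖planarMap a cPlus cMinus Λ q z‖ ≤ Real.exp C * ‖z‖ := by
      intro z
      rcases eq_or_ne z 0 with rfl | hz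
      · simp [h0]
      · rw [← Complex.exp_log hz, h.planarMap_exp, Complex.norm_exp, Complex.norm_exp,
          ← Real.exp_add, Real.exp_le_exp]
        have := (abs_le.1 (hC ((Complex.log z).im / (2 * Real.pi)))).1
        simp [logMap] at this ⊢
        linarith
    refine squeeze_zero_norm hb ?_
    have : Tendsto (fun z : ℂ => Real.exp C * ‖z‖) (𝓝 0) (𝓝 (Real.exp C * ‖(0 : ℂ)‖)) :=
      (continuous_const.mul continuous_norm).tendsto 0
    simpa using this
  · rcases Complex.mem_slitPlane_or_neg_mem_slitPlane hz with hs | hs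
    · have hc : ContinuousAt (fun z => Complex.exp (logMap a cPlus cMinus Λ q (Complex.log z))) z :=
        (Complex.continuous_exp.comp h.continuous_logMap).continuousAt.comp (continuousAt_clog hs)
      refine hc.congr ?_
      filter_upwards [isOpen_ne.mem_nhds hz] with w hw
      rw [← h.planarMap_exp, Complex.exp_log hw]
    · have hc : ContinuousAt (fun z => Complex.exp (logMap a cPlus cMinus Λ q
          (Complex.log (-z) + Real.pi * Complex.I))) z := by
        refine (Complex.continuous_exp.comp h.continuous_logMap).continuousAt.comp
          (f := fun z => Complex.log (-z) + Real.pi * Complex.I) ?_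
        exact (ContinuousAt.comp (f := fun z : ℂ => -z) (continuousAt_clog hs)
          continuous_neg.continuousAt).add continuousAt_const
      refine hc.congr ?_
      filter_upwards [isOpen_ne.mem_nhds hz] with w hw
      rw [← h.planarMap_exp, Complex.exp_add, Complex.exp_log (neg_ne_zero.2 hw),
        Complex.exp_pi_mul_I, mul_neg_one, neg_neg]

theorem planarMap_iterate_exp (h : IsPlanarData a cPlus cMinus Λ q) (n : ℕ) (r t : ℝ) :
    (planarMap a cPlus cMinus Λ q)^[n] (Complex.exp (r + 2 * Real.pi * t * Complex.I)) =
      Complex.exp ((r - radialSum a cPlus cMinus Λ q n t : ℝ) +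
        2 * Real.pi * ((angularMap a cPlus cMinus Λ q)^[n] t : ℝ) * Complex.I) := by
  have hpi : (2 * Real.pi : ℝ) ≠ 0 := by positivity
  induction n with
  | zero => simp [radialSum]
  | succ n ih =>
    rw [Function.iterate_succ_apply', ih, h.planarMap_exp, logMap, Function.iterate_succ_apply']
    have hsucc : radialSum a cPlus cMinus Λ q (n + 1) t = radialSum a cPlus cMinus Λ q n t +
        radialMap a Λ q ((angularMap a cPlus cMinus Λ q)^[n] t) := Finset.sum_range_succ _ _
    have him : (((r - radialSum a cPlus cMinus Λ q n t : ℝ) : ℂ) +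
        2 * Real.pi * ((angularMap a cPlus cMinus Λ q)^[n] t : ℝ) * Complex.I).im /
          (2 * Real.pi) = (angularMap a cPlus cMinus Λ q)^[n] t := by
      simp
    have hre : (((r - radialSum a cPlus cMinus Λ q n t : ℝ) : ℂ) +
        2 * Real.pi * ((angularMap a cPlus cMinus Λ q)^[n] t : ℝ) * Complex.I).re =
          r - radialSum a cPlus cMinus Λ q n t := by
      simp
    rw [him, hre, hsucc]
    push_cast
    ring_nf

/-! ### The index -/

/-- There are `k` points of period `k` in `Λ`, unless `k` is not a modified period. -/
theorem exists_period_finset (h : IsPlanarData a cPlus cMinus Λ q) (k : ℕ) :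
    ∃ F : Finset UnitAddCircle, (∀ α, α ∈ F ↔ α ∈ Λ ∧ Function.minimalPeriod doubling α = k) ∧
      (0 < k → (F.card : ℤ) * turns a k = k * turns a k) := by
  classical
  by_cases hk : ∃ α ∈ Λ, Function.minimalPeriod doubling α = k
  · obtain ⟨α, hα, hαk⟩ := hk
    refine ⟨(Finset.range k).image fun j => doubling^[j] α, fun β => ?_, fun _ => ?_⟩
    · simp only [Finset.mem_image, Finset.mem_range]
      constructor
      · rintro ⟨j, _, rfl⟩
        exact ⟨h.family.invariant.iterate j hα, by
          rw [Function.minimalPeriod_apply_iterate (h.family.periodic hα), hαk]⟩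
      · rintro ⟨hβ, hβk⟩
        obtain ⟨j, hj⟩ := h.family.one_orbit α hα β hβ (hαk.trans hβk.symm)
        refine ⟨j % k, Nat.mod_lt _ (hαk ▸ h.minimalPeriod_pos hα), ?_⟩
        rw [← hαk, Function.iterate_mod_minimalPeriod_eq, hj]
    · rw [Finset.card_image_of_injOn, Finset.card_range]
      intro i hi j hj hij
      simp only [Finset.coe_range] at hi hj
      exact Function.iterate_injOn_Iio_minimalPeriod (by rwa [hαk]) (by rwa [hαk]) hij
  · refine ⟨∅, fun β => ?_, fun hk0 => ?_⟩
    · simp only [Finset.notMem_empty, false_iff]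
      rintro ⟨hβ, hβk⟩
      exact hk ⟨β, hβ, hβk⟩
    -- Without an orbit of period k the count is 0 instead of k, and the factor `turns a k` makes
    -- both sides vanish.
    · have : turns a k = 0 := by
        by_contra hne
        have := (turns_ne_zero_iff hk0).1 hne
        rw [← h.family.periods] at this
        exact hk this
      simp [this]

theorem sum_turns {a : ℕ → ℤ} {n : ℕ} (hn : 0 < n) :
    1 + ∑ k ∈ n.divisors, (k : ℤ) * turns a k = ∑ k ∈ n.divisors, (k : ℤ) * a k := by
  have h1 : (1 : ℕ) ∈ n.divisors := Nat.one_mem_divisors.2 hn.ne'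
  rw [← Finset.add_sum_erase _ _ h1, ← Finset.add_sum_erase _ (fun k : ℕ => (k : ℤ) * a k) h1,
    Finset.sum_congr rfl (g := fun k : ℕ => (k : ℤ) * a k) fun k hk => ?_]
  · simp only [turns, if_true, Nat.cast_one, one_mul]; ring
  · rw [turns, if_neg (Finset.ne_of_mem_erase hk)]

/-- The points of `Λ` fixed by the `n`-th iterate of the doubling map. -/
theorem exists_fixed_finset (h : IsPlanarData a cPlus cMinus Λ q) {n : ℕ} (hn : 0 < n) :
    ∃ S : Finset UnitAddCircle, (∀ α, α ∈ S ↔ α ∈ Λ ∧ doubling^[n] α = α) ∧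
      ∑ α ∈ S, turns a (Function.minimalPeriod doubling α) =
        ∑ k ∈ n.divisors, (k : ℤ) * turns a k := by
  classical
  choose F hF hcard using h.exists_period_finset
  refine ⟨n.divisors.biUnion F, fun α => ?_, ?_⟩
  · simp only [Finset.mem_biUnion, Nat.mem_divisors, hF]
    constructor
    · rintro ⟨k, ⟨hk, _⟩, hα, rfl⟩
      exact ⟨hα, Function.isPeriodicPt_iff_minimalPeriod_dvd.2 hk⟩
    · rintro ⟨hα, hper⟩
      exact ⟨_, ⟨Function.isPeriodicPt_iff_minimalPeriod_dvd.1 hper, hn.ne'⟩, hα, rfl⟩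
  · rw [Finset.sum_biUnion]
    · refine Finset.sum_congr rfl fun k hk => ?_
      rw [Finset.sum_congr rfl (g := fun _ => turns a k) fun α hα => by rw [((hF k α).1 hα).2],
        Finset.sum_const, nsmul_eq_mul, hcard k (Nat.pos_of_mem_divisors hk)]
    · intro k _ l _ hkl
      rw [Function.onFun, Finset.disjoint_left]
      intro α hk hl
      exact hkl (((hF k α).1 hk).2.symm.trans ((hF l α).1 hl).2)

/-- The curve `z ↦ 1 - fⁿ(z) / z` along a circle about the origin. -/
noncomputable def _root_.PlanarIndex.ratioCurve (a : ℕ → ℤ) (cPlus cMinus : ℝ → ℝ)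
    (Λ : Set UnitAddCircle) (q : CircleDeg1Lift) (n : ℕ) (t : ℝ) : ℂ :=
  1 - Complex.exp ((-radialSum a cPlus cMinus Λ q n t : ℝ) +
    (2 * Real.pi * ((angularMap a cPlus cMinus Λ q)^[n] t - t) : ℝ) * Complex.I)

theorem ratioCurve_re (n : ℕ) (t : ℝ) : (ratioCurve a cPlus cMinus Λ q n t).re =
    1 - Real.exp (-radialSum a cPlus cMinus Λ q n t) *
      Real.cos (2 * Real.pi * ((angularMap a cPlus cMinus Λ q)^[n] t - t)) := by
  rw [ratioCurve, Complex.sub_re, Complex.exp_re]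
  simp [-Complex.ofReal_mul, -Complex.ofReal_sub, -Complex.ofReal_neg]

theorem ratioCurve_im (n : ℕ) (t : ℝ) : (ratioCurve a cPlus cMinus Λ q n t).im =
    -(Real.exp (-radialSum a cPlus cMinus Λ q n t) *
      Real.sin (2 * Real.pi * ((angularMap a cPlus cMinus Λ q)^[n] t - t))) := by
  rw [ratioCurve, Complex.sub_im, Complex.exp_im]
  simp [-Complex.ofReal_mul, -Complex.ofReal_sub, -Complex.ofReal_neg]

theorem continuous_ratioCurve (h : IsPlanarData a cPlus cMinus Λ q) (n : ℕ) :
    Continuous (ratioCurve a cPlus cMinus Λ q n) := by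
  have := h.continuous_radialSum n
  have := h.continuous_angularMap.iterate n
  unfold ratioCurve
  fun_prop

theorem ratioCurve_periodic (h : IsPlanarData a cPlus cMinus Λ q) (n : ℕ) :
    Function.Periodic (ratioCurve a cPlus cMinus Λ q n) 1 := by
  intro t
  have h1 := h.radialSum_add_int n t 1
  have h2 := h.angularMap_iterate_add_int n t 1
  simp only [Int.cast_one] at h1 h2
  rw [ratioCurve, ratioCurve, h1, h2]
  congr 1
  rw [Complex.exp_eq_exp_iff_exists_int]
  -- hⁿ has degree 2ⁿ, so hⁿ(t) - t grows by 2ⁿ - 1 over a period.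
  refine ⟨2 ^ n - 1, ?_⟩
  push_cast; ring

theorem ratioCurve_of_fixed {n : ℕ} {t : ℝ} {k : ℤ}
    (hk : (angularMap a cPlus cMinus Λ q)^[n] t = t + k) :
    ratioCurve a cPlus cMinus Λ q n t =
      ((1 - Real.exp (-radialSum a cPlus cMinus Λ q n t) : ℝ) : ℂ) := by
  have e : 2 * Real.pi * ((angularMap a cPlus cMinus Λ q)^[n] t - t) = k * (2 * Real.pi) := by
    rw [hk]; ring
  apply Complex.ext
  · rw [ratioCurve_re, e, Real.cos_int_mul_two_pi, mul_one, Complex.ofReal_re]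
  · have hs : Real.sin (k * (2 * Real.pi)) = 0 := by
      simpa using Real.sin_add_int_mul_two_pi 0 k
    rw [ratioCurve_im, e, hs, mul_zero, neg_zero, Complex.ofReal_im]

/-- A real value ≤ 0 means that fⁿ(z)/z is real and ≥ 1: the sine vanishes and the cosine is
positive, so it is 1. -/
theorem ratioCurve_mem_slitPlane_or (n : ℕ) (t : ℝ) :
    ratioCurve a cPlus cMinus Λ q n t ∈ Complex.slitPlane ∨
      ∃ k : ℤ, (angularMap a cPlus cMinus Λ q)^[n] t = t + k := by
  rw [or_iff_not_imp_left, Complex.mem_slitPlane_iff, not_or, not_lt, not_not, ratioCurve_re,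
    ratioCurve_im, neg_eq_zero, mul_eq_zero, or_iff_right (Real.exp_pos _).ne']
  rintro ⟨h1, h2⟩
  have hE := Real.exp_pos (-radialSum a cPlus cMinus Λ q n t)
  have hcos : 0 < Real.cos (2 * Real.pi * ((angularMap a cPlus cMinus Λ q)^[n] t - t)) := by
    by_contra! hle
    nlinarith
  have h3 := Real.sin_sq_add_cos_sq (2 * Real.pi * ((angularMap a cPlus cMinus Λ q)^[n] t - t))
  have h4 : Real.cos (2 * Real.pi * ((angularMap a cPlus cMinus Λ q)^[n] t - t)) = 1 := by
    rw [h2] at h3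
    nlinarith
  obtain ⟨k, hk⟩ := (Real.cos_eq_one_iff _).1 h4
  refine ⟨k, ?_⟩
  have := Real.pi_pos
  have : (2 * Real.pi) * k = (2 * Real.pi) * ((angularMap a cPlus cMinus Λ q)^[n] t - t) := by
    linarith
  have := mul_left_cancel₀ (by positivity) this
  linarith

/-- The curve crosses the negative real axis at the centre of each piece of a periodic sector, in
the direction given by the sign of the sector. -/
theorem ratioCurve_crossing (h : IsPlanarData a cPlus cMinus Λ q) {n : ℕ} (hn : 0 < n) {x : ℝ}
    (hx : (x : UnitAddCircle) ∈ Λ) {k : ℤ} (hk : 2 ^ n * x = x + k) {i : ℕ}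
    (hi : i < sectorCount a (x : UnitAddCircle)) {σ : ℤ}
    (hσ : σ = (turns a (Function.minimalPeriod doubling (x : UnitAddCircle))).sign) {p : ℝ}
    (hp : p = leftEnd q x + (rightEnd q x - leftEnd q x) *
      pieceCentre (sectorCount a (x : UnitAddCircle)) i) :
    ∀ᶠ t in 𝓝 p,
      ((σ : ℝ) * (t - p) < 0 → 0 < (ratioCurve a cPlus cMinus Λ q n t).im) ∧
      (0 < (σ : ℝ) * (t - p) → (ratioCurve a cPlus cMinus Λ q n t).im < 0) := by
  have hlt := (h.blowUp.leftEnd_lt_rightEnd_iff x).2 (subset_backwardOrbit Λ hx)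
  have hlen : 0 < rightEnd q x - leftEnd q x := sub_pos.2 hlt
  have hu := pieceCentre_mem hi
  have hm : (0 : ℝ) < sectorCount a (x : UnitAddCircle) :=
    Nat.cast_pos.2 (h.sectorCount_pos hx)
  have hσ' : σ = 1 ∨ σ = -1 := by
    rcases lt_or_gt_of_ne (h.turns_ne_zero hx) with h1 | h1
    · exact Or.inr (hσ.trans (Int.sign_eq_neg_one_of_neg h1))
    · exact Or.inl (hσ.trans (Int.sign_eq_one_of_pos h1))
  have hprof := h.isSignedProfile hx
  rw [← hσ] at hprof
  have hpmem : p ∈ Ioo (leftEnd q x) (rightEnd q x) := by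
    rw [hp]; constructor <;> nlinarith [hu.1, hu.2]
  have hdisp : ∀ t ∈ Icc (leftEnd q x) (rightEnd q x),
      (angularMap a cPlus cMinus Λ q)^[n] t - t = k + (rightEnd q x - leftEnd q x) *
        ((modelAngle (sectorCount a (x : UnitAddCircle))
            (sectorProfile a cPlus cMinus (x : UnitAddCircle)))^[n] (fibreCoord q t) -
          fibreCoord q t) := by
    intro t ht
    have hqt := h.blowUp.map_eq_iff.2 ht
    rw [← sectorMap_of_mem (Λ := Λ) hx, ← hqt]
    exact h.angularMap_iterate_sub_self (by rwa [hqt]) (by rwa [hqt])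
  have hcoord : ∀ t ∈ Icc (leftEnd q x) (rightEnd q x), fibreCoord q t -
      pieceCentre (sectorCount a (x : UnitAddCircle)) i =
        (t - p) / (rightEnd q x - leftEnd q x) := by
    intro t ht
    rw [fibreCoord, h.blowUp.map_eq_iff.2 ht, hp]
    field_simp
    ring
  have hpD : (angularMap a cPlus cMinus Λ q)^[n] p - p - k = 0 := by
    rw [hdisp p (Ioo_subset_Icc_self hpmem)]
    have := hcoord p (Ioo_subset_Icc_self hpmem)
    rw [sub_self, zero_div, sub_eq_zero] at this
    rw [this, Function.iterate_fixed (modelAngle_pieceCentre hi _)]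
    ring
  -- Within 1/2 the sine of 2π times the displacement has the sign of the displacement. The bound
  -- 1/(2m) below is half a piece in the fibre coordinate.
  have hev1 : ∀ᶠ t in 𝓝 p, |(angularMap a cPlus cMinus Λ q)^[n] t - t - k| < 1 / 2 := by
    have := h.continuous_angularMap.iterate n
    have hc : ContinuousAt
        (fun t => |(angularMap a cPlus cMinus Λ q)^[n] t - t - k|) p := by fun_prop
    refine hc.eventually (gt_mem_nhds ?_)
    simp only [hpD]; norm_num
  have hev2 : ∀ᶠ t in 𝓝 p, |(t - p) / (rightEnd q x - leftEnd q x)| <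
      1 / (2 * sectorCount a (x : UnitAddCircle)) := by
    have hc : ContinuousAt (fun t => |(t - p) / (rightEnd q x - leftEnd q x)|) p := by fun_prop
    refine hc.eventually (gt_mem_nhds ?_)
    simp only [sub_self, zero_div, abs_zero]
    positivity
  filter_upwards [hev1, hev2, Icc_mem_nhds hpmem.1 hpmem.2] with t ht1 ht2 ht3
  have hmod := modelAngle_iterate_near_centre hprof hσ' hn hi
    (t := fibreCoord q t) (by rwa [hcoord t ht3])
  rw [hcoord t ht3, mul_div_assoc'] at hmod
  have hE := Real.exp_pos (-radialSum a cPlus cMinus Λ q n t)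
  have hpi := Real.pi_pos
  have hsin : Real.sin (2 * Real.pi * ((angularMap a cPlus cMinus Λ q)^[n] t - t)) =
      Real.sin (2 * Real.pi * ((angularMap a cPlus cMinus Λ q)^[n] t - t - k)) := by
    rw [← Real.sin_sub_int_mul_two_pi _ k]; congr 1; ring
  rw [ratioCurve_im, hsin]
  rw [abs_lt] at ht1
  have hd := hdisp t ht3
  constructor
  · intro hneg
    have h1 := hmod.2 (div_neg_of_neg_of_pos hneg hlen)
    have h2 := mul_neg_of_pos_of_neg hlen (sub_neg.2 h1)
    have h3 : Real.sin (2 * Real.pi * ((angularMap a cPlus cMinus Λ q)^[n] t - t - k)) < 0 :=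
      Real.sin_neg_of_neg_of_neg_pi_lt (by nlinarith) (by nlinarith)
    nlinarith
  · intro hpos
    have h1 := hmod.1 (div_pos hpos hlen)
    have h2 := mul_pos hlen (sub_pos.2 h1)
    have h3 : 0 < Real.sin (2 * Real.pi * ((angularMap a cPlus cMinus Λ q)^[n] t - t - k)) :=
      Real.sin_pos_of_pos_of_lt_pi (by nlinarith) (by nlinarith)
    nlinarith

theorem ratioCurve_lift (h : IsPlanarData a cPlus cMinus Λ q) {n : ℕ} (hn : 0 < n) :
    ∃ θ : ℝ → ℝ, Continuous θ ∧
      (∀ t, ratioCurve a cPlus cMinus Λ q n t ≠ 0 ∧ ratioCurve a cPlus cMinus Λ q n t =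
        (‖ratioCurve a cPlus cMinus Λ q n t‖ : ℂ) * Complex.exp (θ t * Complex.I)) ∧
      θ 1 - θ 0 = 2 * Real.pi * ((∑ k ∈ n.divisors, (k : ℤ) * turns a k : ℤ) : ℝ) := by
  obtain ⟨S, hS, hsum⟩ := h.exists_fixed_finset hn
  choose rep hrep using (QuotientAddGroup.mk_surjective :
    Function.Surjective ((↑) : ℝ → UnitAddCircle))
  have hrep' : ∀ α : UnitAddCircle, ((rep α : ℝ) : UnitAddCircle) = α := hrep
  set ι := Σ α : S, Fin (sectorCount a (α : UnitAddCircle))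
  set p : ι → ℝ := fun i => leftEnd q (rep i.1) + (rightEnd q (rep i.1) - leftEnd q (rep i.1)) *
    pieceCentre (sectorCount a (i.1 : UnitAddCircle)) i.2 with hp
  set σ : ι → ℤ := fun i => (turns a (Function.minimalPeriod doubling (i.1 : UnitAddCircle))).sign
    with hσdef
  have hΛ : ∀ i : ι, (i.1 : UnitAddCircle) ∈ Λ := fun i => ((hS _).1 i.1.2).1
  have hper : ∀ i : ι, doubling^[n] (i.1 : UnitAddCircle) = i.1 := fun i => ((hS _).1 i.1.2).2
  have hmem : ∀ i : ι, pieceCentre (sectorCount a (i.1 : UnitAddCircle)) i.2 ∈ Icc (0 : ℝ) 1 :=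
    fun i => Ioo_subset_Icc_self (pieceCentre_mem i.2.2)
  have hqp : ∀ i, q (p i) = rep i.1 := fun i => h.blowUp.map_leftEnd_add_mul _ (hmem i)
  have hqp' : ∀ i, (q (p i) : UnitAddCircle) = i.1 := fun i => by rw [hqp, hrep']
  have hfp : ∀ i, fibreCoord q (p i) = pieceCentre (sectorCount a (i.1 : UnitAddCircle)) i.2 :=
    fun i => h.blowUp.fibreCoord_leftEnd_add_mul
      (by rw [hrep']; exact subset_backwardOrbit Λ (hΛ i)) (hmem i)
  have hrot : ∀ i : ι, ∃ k : ℤ, 2 ^ n * rep i.1 = rep i.1 + k := fun i =>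
    exists_int_of_coe_eq (by rw [coe_two_pow_mul, hrep', hper])
  have hfix : ∀ i : ι, ∃ k : ℤ, (angularMap a cPlus cMinus Λ q)^[n] (p i) = p i + k := by
    intro i
    obtain ⟨k, hk⟩ := hrot i
    refine ⟨k, ?_⟩
    have := h.angularMap_iterate_sub_self (y := p i) (by rw [hqp']; exact hΛ i)
      (by rw [hqp]; exact hk)
    rw [hqp', sectorMap_of_mem (hΛ i), hfp,
      Function.iterate_fixed (modelAngle_pieceCentre i.2.2 _), sub_self, mul_zero] at this
    linarith
  have hσ : ∀ i, σ i = 1 ∨ σ i = -1 := by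
    intro i
    rcases lt_or_gt_of_ne (h.turns_ne_zero (hΛ i)) with h1 | h1
    · exact Or.inr (Int.sign_eq_neg_one_of_neg h1)
    · exact Or.inl (Int.sign_eq_one_of_pos h1)
  have hval : ∀ i, ratioCurve a cPlus cMinus Λ q n (p i) =
      ((1 - Real.exp (-radialSum a cPlus cMinus Λ q n (p i)) : ℝ) : ℂ) := fun i => by
    obtain ⟨k, hk⟩ := hfix i
    exact ratioCurve_of_fixed hk
  -- Each α carries |t| pieces of sign sgn t, so its pieces sum to t.
  have hσsum : ∑ i, σ i = ∑ k ∈ n.divisors, (k : ℤ) * turns a k := by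
    rw [← hsum, ← Finset.sum_coe_sort S fun α => turns a (Function.minimalPeriod doubling α),
      Fintype.sum_sigma]
    refine Finset.sum_congr rfl fun α _ => ?_
    simp only [hσdef, Finset.sum_const, Finset.card_univ, Fintype.card_fin, nsmul_eq_mul]
    rw [sectorCount, mul_comm, Int.sign_mul_natAbs]
  rw [← hσsum]
  refine hasWindingNumber_of_crossings (h.continuous_ratioCurve n) (h.ratioCurve_periodic n) p σ
    hσ ?_ ?_ ?_ ?_ ?_
  · intro i j k hij
    have h1 : (q (p i) : UnitAddCircle) = q (p j) := by rw [hij, q.map_add_int, coe_add_int]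
    have h2 : fibreCoord q (p i) = fibreCoord q (p j) := by
      rw [hij, h.blowUp.fibreCoord_add_int]
    rw [hqp', hqp'] at h1
    rw [hfp, hfp] at h2
    obtain ⟨α, i, hi⟩ := i
    obtain ⟨β, j, hj⟩ := j
    have hαβ : α = β := Subtype.ext h1
    subst hαβ
    simp only at h2
    have h3 := floor_pieceCentre hi
    rw [h2, floor_pieceCentre hj] at h3
    have h4 : j = i := by exact_mod_cast h3
    subst h4
    rfl
  · intro t ht
    rcases ratioCurve_mem_slitPlane_or (a := a) (cPlus := cPlus) (cMinus := cMinus) (Λ := Λ)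
      (q := q) n t with hs | ⟨k, hk⟩
    · exact hs
    · obtain ⟨hpt, hpos | ⟨hmemΛ, i, hi, hci⟩⟩ := h.radialSum_pos_or hn hk
      · rw [ratioCurve_of_fixed hk]
        left
        rw [Complex.ofReal_re, sub_pos, Real.exp_lt_one_iff]
        linarith
      · exfalso
        -- The lift q t of its angle differs from the chosen representative by an integer l, so t is
        -- the translate by l of a listed crossing.
        obtain ⟨l, hl⟩ := exists_int_of_coe_eq (hrep' (q t : UnitAddCircle)).symm
        refine ht ⟨⟨(q t : UnitAddCircle), (hS _).2 ⟨hmemΛ, hpt⟩⟩, ⟨i, hi⟩⟩ l ?_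
        have h1 := h.blowUp.leftEnd_add_mul_fibreCoord t
        rw [hci] at h1
        conv_lhs => rw [← h1]
        simp only [hp]
        have h2 := h.blowUp.leftEnd_add_int (rep (q t : UnitAddCircle)) l
        have h3 := h.blowUp.rightEnd_add_int (rep (q t : UnitAddCircle)) l
        rw [← hl] at h2 h3
        rw [h2, h3]
        ring
  · intro i
    rw [hval, Complex.ofReal_re, sub_neg, Real.one_lt_exp_iff, neg_pos]
    have hi : (i.2 : ℕ) < sectorCount a (q (p i) : UnitAddCircle) := by
      rw [hqp']; exact i.2.2
    refine h.radialSum_neg (by rw [hqp']; exact hΛ i) hn (by rw [hqp', hper]) hi ?_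
    rw [hfp, hqp']
  · intro i
    rw [hval, Complex.ofReal_im]
  · intro i
    obtain ⟨k, hk⟩ := hrot i
    refine h.ratioCurve_crossing hn (x := rep i.1) (by rw [hrep']; exact hΛ i) hk
      (i := i.2) (by rw [hrep']; exact i.2.2) (by rw [hrep']) ?_
    rw [hrep']

theorem sub_planarMap_iterate (h : IsPlanarData a cPlus cMinus Λ q) (n : ℕ) {R : ℝ} (hR : 0 < R)
    (t : ℝ) : circleCurve 0 R t - (planarMap a cPlus cMinus Λ q)^[n] (circleCurve 0 R t) =
      R * Complex.exp ((2 * Real.pi * t : ℝ) * Complex.I) *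
        ratioCurve a cPlus cMinus Λ q n t := by
  have hRe : (R : ℂ) = Complex.exp (Real.log R : ℝ) := by
    rw [← Complex.ofReal_exp, Real.exp_log hR]
  have hc : circleCurve 0 R t =
      Complex.exp ((Real.log R : ℝ) + 2 * Real.pi * t * Complex.I) := by
    rw [circleCurve, zero_add, Complex.exp_add, ← hRe]
  rw [hc, h.planarMap_iterate_exp, ratioCurve, hRe, mul_sub, mul_one, ← Complex.exp_add,
    ← Complex.exp_add]
  congr 2 <;> push_cast <;> ring

end IsPlanarData

end PlanarIndex

/-! ### The index formula -/

open PlanarIndex in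
theorem mainTheorem2 (a : ℕ → ℤ)
    (cPlus cMinus : ℝ → ℝ)
    (hPlus : PlanarIndex.IsPlusProfile cPlus) (hMinus : PlanarIndex.IsMinusProfile cMinus)
    (Λ : Set UnitAddCircle)
    (hΛ : PlanarIndex.IsOrbitFamily (PlanarIndex.modifiedPeriods a) Λ)
    (q : CircleDeg1Lift) (hq : PlanarIndex.IsBlowUp q (PlanarIndex.backwardOrbit Λ))
    (n : ℕ) (hn : 1 ≤ n) :
    PlanarIndex.HasFixedPointIndex ((PlanarIndex.planarMap a cPlus cMinus Λ q)^[n]) 0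
      (∑ k ∈ n.divisors, (k : ℤ) * a k) := by
  have h : IsPlanarData a cPlus cMinus Λ q := ⟨hPlus, hMinus, hΛ, hq⟩
  obtain ⟨θ, hθc, hθ, hθ1⟩ := h.ratioCurve_lift hn
  -- The radius 1 is arbitrary: a fixed point z ≠ 0 of fⁿ would be a zero of `ratioCurve`, which has
  -- none. The angle 2πt + θ(t) adds the turn of the circle to that of `ratioCurve`.
  refine ⟨h.continuous_planarMap.iterate n, ?_, ⟨1, one_pos, fun z _ hz => ?_⟩,
    fun R hR => ⟨fun t => 2 * Real.pi * t + θ t, by fun_prop, fun t _ => ?_, ?_⟩⟩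
  · exact Function.iterate_fixed (by rw [planarMap, if_pos rfl]) n
  · by_contra hz0
    have hR : 0 < ‖z‖ := norm_pos_iff.2 hz0
    have hzc : circleCurve 0 ‖z‖ (z.arg / (2 * Real.pi)) = z := by
      rw [circleCurve, zero_add]
      conv_rhs => rw [← Complex.norm_mul_exp_arg_mul_I z]
      congr 3
      push_cast
      have : (Real.pi : ℂ) ≠ 0 := Complex.ofReal_ne_zero.2 Real.pi_ne_zero
      field_simp
    have h1 := h.sub_planarMap_iterate n hR (z.arg / (2 * Real.pi))
    rw [hzc, hz, sub_self, eq_comm, mul_eq_zero, mul_eq_zero] at h1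
    rcases h1 with (h1 | h1) | h1
    · exact hR.ne' (Complex.ofReal_eq_zero.1 h1)
    · exact Complex.exp_ne_zero _ h1
    · exact (hθ _).1 h1
  · simp only [h.sub_planarMap_iterate n hR.1]
    have hR' : (R : ℂ) ≠ 0 := Complex.ofReal_ne_zero.2 hR.1.ne'
    refine ⟨mul_ne_zero (mul_ne_zero hR' (Complex.exp_ne_zero _)) (hθ t).1, ?_⟩
    rw [norm_mul, norm_mul, Complex.norm_exp_ofReal_mul_I, Complex.norm_of_nonneg hR.1.le, mul_one]
    conv_lhs => rw [(hθ t).2]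
    rw [Complex.ofReal_add, add_mul, Complex.exp_add]
    push_cast
    ring
  · rw [← IsPlanarData.sum_turns hn]
    push_cast at hθ1 ⊢
    linear_combination hθ1
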